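/- Let $m\ge 0$, let $\omega_0,\dots,\omega_m\ge 0$ be integers and let $a_0=1,a_1,\dots,a_m$ be positive integers such that $\mathbb P(1,a_1,\dots,a_m)$ is well-formed, i.e. $\gcd(a_0,\dots,\widehat{a_i},\dots,a_m)=1$ for every $i$ (so $m\ge1$). Let $\mathcal F$ be the weighted bundle over $\mathbb P^1$, i.e. the quotient variety $(\mathbb C^{m+3}-V(I))/(\mathbb C^*)^2$ with Cox ring $\mathbb C[x_0,x_1,y_0,\dots,y_m]$, irrelevant ideal $I=(x_0,x_1)\cap(y_0,\dots,y_m)$ and weights $$\begin{pmatrix}1&1&-\omega_0&\cdots&-\omega_m\\0&0&a_0&\cdots&a_m\end{pmatrix}.$$ Fix $k\in\{0,\dots,m\}$ and strictly positive integers $b_0,\dots,b_m$ with $b_i\equiv a_i \pmod{a_k}$ for $i\ne k$ and $b_k=r a_k$ for some positive integer $r$. Let $T=[(\mathbb C^{m+4}-V(J))/(\mathbb C^*)^3]$ be the toric stack with Cox ring $\mathbb C[X_0,X_1,Y_0,\dots,Y_m,\xi]$, irrelevant ideal $$J=(X_0,X_1)\cap(Y_0,\dots,Y_m)\cap(\xi,X_1)\cap(\xi,Y_k)\cap(X_0,Y_0,\dots,\widehat{Y_k},\dots,Y_m)$$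 and weight matrix $$\begin{pmatrix}1&1&-\omega_0&\cdots&-\omega_k&\cdots&-\omega_m&0\\0&0&a_0&\cdots&a_k&\cdots&a_m&0\\ b_k&0&b_0&\cdots&0&\cdots&b_m&-a_k\end{pmatrix}.$$ Then $T$ has rank $3$ and is the toric weighted blow up of $\mathcal F$ at the point $p=(0:1;0:\dots:1:\dots:0)$ (with $y_k=1$), in the following sense. (1) Let $\alpha_1,\beta_1,\dots,\beta_m$ be the standard basis of $\mathbb Z^{m+1}$, $\beta_0=-\sum_{i\ge1}a_i\beta_i$ and $\alpha_0=-\alpha_1+\sum_{i\ge0}\omega_i\beta_i$. The cones spanned by all of the $\alpha$'s and $\beta$'s except one $\alpha_s$ and one $\beta_j$, with their faces, form a simplicial fan $\Sigma$. Its irrelevant ideal is $I$, and the group $\{t\in(\mathbb C^*)^{m+3}:\prod_\rho t_\rho^{\langle e,u_\rho\rangle}=1 \text{ for all } e\in\operatorname{Hom}(\mathbb Z^{m+1},\mathbb Z)\}$ of its quotient construction (where $u_\rho$ runs over the given ray vectors) is the faithful image of $(\mathbb C^*)^2$ under the weights of $\mathcal F$. So $\mathcal F$ is the toric variety of $\Sigma$.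 (2) There is $\gamma\in\mathbb Z^{m+1}$ with $a_k\gamma=b_k\alpha_0+\sum_{i\ne k}b_i\beta_i$, a vector in the interior of the cone of $p$. The star subdivision of $\Sigma$ at $\gamma$ is a simplicial fan. Its irrelevant ideal, with $X_s,Y_i,\xi$ corresponding to $\alpha_s,\beta_i,\gamma$, is $J$. The group of its quotient construction, formed with the vectors $\alpha_s,\beta_i,\gamma$, is the image of $(\mathbb C^*)^3$ under the weights of $T$. The kernel of this action of $(\mathbb C^*)^3$ (the generic stabiliser of $T$) is cyclic of order $a_k$. So the coarse moduli space $(\mathbb C^{m+4}-V(J))/(\mathbb C^*)^3$ of $T$ is the toric variety of the star subdivision. (3) The rule $$(X_0,X_1,Y_0,\dots,Y_m,\xi)\mapsto(X_0\xi^{b_k/a_k}:X_1;\ \dots:Y_i\xi^{b_i/a_k}:\dots:Y_k:\dots)$$ (for any choice of $\xi^{1/a_k}$, the same in all coordinates) defines a morphism $\pi$ from the coarse moduli space of $T$ to $\mathcal F$. It is surjective, it is an isomorphism over $\mathcal F-\{p\}$, and $\pi^{-1}(p)=\{\xi=0\}$. The open set $\{x_1y_k\ne0\}\ni p$ is identified,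 by setting $x_1=y_k=1$, with the cyclic quotient singularity $\mathbb C^{m+1}/\mu_{a_k}$ of type $\frac1{a_k}(0,a_0,\dots,\widehat{a_k},\dots,a_m)$ in the coordinates $x_0,y_i$ $(i\ne k)$, with $p$ at the origin, and over it $\pi$ is the weighted blow up of the origin with weights $\frac1{a_k}(b_k,b_0,\dots,\widehat{b_k},\dots,b_m)$. Here the weighted blow up of $\mathbb C^{m+1}/\mu_{a_k}$ with weights $\frac1{a_k}(b)$ is the quotient by $\mu_{a_k}$ of the weighted blow up $((\mathbb C^{m+1}-0)\times\mathbb C)/\mathbb C^*\to\mathbb C^{m+1}$, $(z,u)\mapsto(u^{b_v}z_v)_v$, where $t\in\mathbb C^*$ acts by $(t^{b_v}z_v,t^{-1}u)$, and $\mu_{a_k}$ acts on the coordinates $z$ with the weights of the singularity and trivially on $u$. -/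

import Mathlib

open MvPolynomial

namespace ToricBlowUp

/-! ### Complex varieties as spaces with functions -/

/-- A space with functions over `ℂ`: a topological space with a sheaf of `ℂ`-algebras of complex
valued functions. A function on an open set `U` is represented by a total function, of which only
the restriction to `U` matters. -/
structure SpaceWithFunctions where
  carrier : Type
  [top : TopologicalSpace carrier]
  /-- `reg U` is the set of functions that are regular on the open set `U`. -/
  reg : Set carrier → Set (carrier → ℂ)
  const_mem : ∀ U : Set carrier, IsOpen U → ∀ c : ℂ, (fun _ => c) ∈ reg U
  add_mem : ∀ U : Set carrier, IsOpen U → ∀ f ∈ reg U, ∀ g ∈ reg U, f + g ∈ reg U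
  mul_mem : ∀ U : Set carrier, IsOpen U → ∀ f ∈ reg U, ∀ g ∈ reg U, f * g ∈ reg U
  mem_iff_locally : ∀ U : Set carrier, IsOpen U → ∀ f : carrier → ℂ, f ∈ reg U ↔
    ∀ x ∈ U, ∃ V : Set carrier, IsOpen V ∧ x ∈ V ∧ V ⊆ U ∧ ∃ g ∈ reg V, Set.EqOn f g V

instance : CoeSort SpaceWithFunctions Type := ⟨SpaceWithFunctions.carrier⟩

instance (X : SpaceWithFunctions) : TopologicalSpace X := X.top

/-- Morphisms: continuous maps that pull regular functions back to regular functions. -/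
def IsMorphism {X Y : SpaceWithFunctions} (f : X → Y) : Prop :=
  Continuous f ∧ ∀ V : Set Y, IsOpen V → ∀ g ∈ Y.reg V, g ∘ f ∈ X.reg (f ⁻¹' V)

/-- The restriction of the morphism `f` to the open set `W` is an open immersion, that is, an
isomorphism of `W` onto an open subspace of the target. -/
def IsOpenImmersionOn {X Y : SpaceWithFunctions} (f : X → Y) (W : Set X) : Prop :=
  IsMorphism f ∧ IsOpen W ∧ Set.InjOn f W ∧
    ∀ V : Set X, IsOpen V → V ⊆ W →
      IsOpen (f '' V) ∧ ∀ g ∈ X.reg V, ∃ h ∈ Y.reg (f '' V), ∀ x ∈ V, h (f x) = g x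

/-- The quotient of a space with functions by an equivalence relation: the quotient topology, and
the functions that become regular upstairs. -/
def SpaceWithFunctions.quotient (X : SpaceWithFunctions) (s : Setoid X) : SpaceWithFunctions where
  carrier := Quotient s
  top := inferInstance
  reg U := {f | f ∘ Quotient.mk s ∈ X.reg (Quotient.mk s ⁻¹' U)}
  const_mem U hU c := X.const_mem _ (hU.preimage continuous_quotient_mk') c
  add_mem U hU f hf g hg := X.add_mem _ (hU.preimage continuous_quotient_mk') _ hf _ hg
  mul_mem U hU f hf g hg := X.mul_mem _ (hU.preimage continuous_quotient_mk') _ hf _ hg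
  mem_iff_locally U hU f := by
    constructor
    · exact fun hf x hx => ⟨U, hU, hx, subset_rfl, f, hf, fun _ _ => rfl⟩
    · intro h
      refine (X.mem_iff_locally _ (hU.preimage continuous_quotient_mk') _).2 fun z hz => ?_
      obtain ⟨V, hV, hzV, hVU, g, hg, hfg⟩ := h _ hz
      exact ⟨Quotient.mk s ⁻¹' V, hV.preimage continuous_quotient_mk', hzV,
        Set.preimage_mono hVU, g ∘ Quotient.mk s, hg, fun w hw => hfg hw⟩

/-- The Zariski topology on a subset of the affine space `ℂ^ι`. -/
@[reducible]
def zariskiTopology {ι : Type} (Z : Set (ι → ℂ)) : TopologicalSpace Z :=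
  TopologicalSpace.generateFrom
    (Set.range fun P : MvPolynomial ι ℂ => {z : Z | eval z.1 P ≠ 0})

/-- A subset `Z` of the affine space `ℂ^ι`, with the Zariski topology and with the functions that
are locally quotients of polynomials. -/
def zariskiSpace {ι : Type} (Z : Set (ι → ℂ)) : SpaceWithFunctions :=
  letI : TopologicalSpace Z := zariskiTopology Z
  { carrier := Z
    reg := fun U => {f | ∀ z ∈ U, ∃ V : Set Z, IsOpen V ∧ z ∈ V ∧ V ⊆ U ∧
      ∃ P Q : MvPolynomial ι ℂ, ∀ w ∈ V, eval w.1 Q ≠ 0 ∧ f w = eval w.1 P / eval w.1 Q}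
    const_mem := fun U hU c z hz =>
      ⟨U, hU, hz, subset_rfl, C c, 1, fun w _ => by simp⟩
    add_mem := fun U _ f hf g hg z hz => by
      obtain ⟨V, hV, hzV, hVU, P, Q, h⟩ := hf z hz
      obtain ⟨V', hV', hzV', _, P', Q', h'⟩ := hg z hz
      refine ⟨V ∩ V', hV.inter hV', ⟨hzV, hzV'⟩, Set.inter_subset_left.trans hVU,
        P * Q' + Q * P', Q * Q', fun w hw => ?_⟩
      obtain ⟨h1, h2⟩ := h w hw.1
      obtain ⟨h3, h4⟩ := h' w hw.2
      refine ⟨by simp [h1, h3], ?_⟩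
      simp only [Pi.add_apply, h2, h4, map_add, map_mul, div_add_div _ _ h1 h3]
    mul_mem := fun U _ f hf g hg z hz => by
      obtain ⟨V, hV, hzV, hVU, P, Q, h⟩ := hf z hz
      obtain ⟨V', hV', hzV', _, P', Q', h'⟩ := hg z hz
      refine ⟨V ∩ V', hV.inter hV', ⟨hzV, hzV'⟩, Set.inter_subset_left.trans hVU,
        P * P', Q * Q', fun w hw => ?_⟩
      obtain ⟨h1, h2⟩ := h w hw.1
      obtain ⟨h3, h4⟩ := h' w hw.2
      refine ⟨by simp [h1, h3], ?_⟩
      simp only [Pi.mul_apply, h2, h4, map_mul, div_mul_div_comm]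
    mem_iff_locally := fun U hU f => by
      constructor
      · exact fun hf x hx => ⟨U, hU, hx, subset_rfl, f, hf, fun _ _ => rfl⟩
      · intro h z hz
        obtain ⟨V, _, hzV, hVU, g, hg, hfg⟩ := h z hz
        obtain ⟨V', hV', hzV', hVV', P, Q, hPQ⟩ := hg z hzV
        exact ⟨V', hV', hzV', hVV'.trans hVU, P, Q, fun w hw =>
          ⟨(hPQ w hw).1, by rw [hfg (hVV' hw)]; exact (hPQ w hw).2⟩⟩ }

/-! ### Quotients of open subsets of affine space by groups of diagonal matrices -/

/-- The complement in `ℂ^ι` of the zero set of the ideal `I`. -/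
def stableLocus {ι : Type} (I : Ideal (MvPolynomial ι ℂ)) : Set (ι → ℂ) := (zeroLocus ℂ I)ᶜ

/-- Two points of `ℂ^ι - V(I)` are equivalent if an element of `G ⊆ (ℂ^*)^ι` maps one of them to
the other. -/
def orbitSetoid {ι : Type} (I : Ideal (MvPolynomial ι ℂ)) (G : Subgroup (ι → ℂˣ)) :
    Setoid (zariskiSpace (stableLocus I)) where
  r z w := ∃ t ∈ G, ∀ i, w.1 i = (t i : ℂ) * z.1 i
  iseqv :=
    { refl := fun z => ⟨1, G.one_mem, by simp⟩
      symm := by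
        rintro z w ⟨t, ht, h⟩
        exact ⟨t⁻¹, G.inv_mem ht, fun i => by simp [h i]⟩
      trans := by
        rintro z w v ⟨t, ht, h⟩ ⟨t', ht', h'⟩
        exact ⟨t' * t, G.mul_mem ht' ht, fun i => by
          simp only [h', h, Pi.mul_apply, Units.val_mul, mul_assoc]⟩ }

/-- The quotient `(ℂ^ι - V(I)) / G` for a group `G ⊆ (ℂ^*)^ι` of diagonal matrices. -/
def quotientSpace {ι : Type} (I : Ideal (MvPolynomial ι ℂ)) (G : Subgroup (ι → ℂˣ)) :
    SpaceWithFunctions :=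
  (zariskiSpace (stableLocus I)).quotient (orbitSetoid I G)

/-- The point of `(ℂ^ι - V(I)) / G` with homogeneous coordinates `z`. -/
def quotientSpace.mk {ι : Type} {I : Ideal (MvPolynomial ι ℂ)} {G : Subgroup (ι → ℂˣ)}
    (z : ι → ℂ) (hz : z ∈ stableLocus I) : quotientSpace I G :=
  Quotient.mk (orbitSetoid I G) ⟨z, hz⟩

/-- The homomorphism `(ℂ^*)^r → (ℂ^*)^ι` of tori given by a weight matrix `A`:
`λ ↦ (∏ i, λ_i ^ A_{ij})_j`. -/
def weightHom {ι : Type} {r : ℕ} (A : Matrix (Fin r) ι ℤ) : (Fin r → ℂˣ) →* (ι → ℂˣ) where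
  toFun t j := ∏ i, t i ^ A i j
  map_one' := by ext; simp
  map_mul' s t := by
    funext j
    simp only [Pi.mul_apply, mul_zpow, Finset.prod_mul_distrib]

/-- A toric stack `[(ℂ^ι - V(I)) / (ℂ^*)^r]`, given by its Cox ring `ℂ[x_j : j ∈ ι]`, its
irrelevant ideal `I` and the matrix `A` of weights of the action
`λ · x_j = (∏ i, λ_i ^ A_{ij}) x_j`. -/
structure ToricStack (ι : Type) (r : ℕ) where
  irrelevantIdeal : Ideal (MvPolynomial ι ℂ)
  weights : Matrix (Fin r) ι ℤ

/-- The subgroup of `(ℂ^*)^ι` through which the torus `(ℂ^*)^r` of a toric stack acts. -/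
def ToricStack.group {ι : Type} {r : ℕ} (T : ToricStack ι r) : Subgroup (ι → ℂˣ) :=
  (weightHom T.weights).range

/-- The quotient variety `(ℂ^ι - V(I)) / (ℂ^*)^r`, the coarse moduli space of the toric stack. -/
abbrev ToricStack.variety {ι : Type} {r : ℕ} (T : ToricStack ι r) : SpaceWithFunctions :=
  quotientSpace T.irrelevantIdeal T.group

/-! ### Stacky fans, their Cox data, and star subdivisions -/

/-- A stacky fan in the lattice `ℤ^d`, given by vectors `ray i` on its rays and by the index sets
of its (simplicial) cones; the fan axioms are the predicate `StackyFan.IsFan`. -/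
structure StackyFan (d : ℕ) (ι : Type) where
  ray : ι → Fin d → ℤ
  cones : Set (Finset ι)

namespace StackyFan

variable {d : ℕ} {ι : Type} [Fintype ι] [DecidableEq ι]

/-- The vector on the `i`-th ray, in the real vector space spanned by the lattice. -/
def realRay (S : StackyFan d ι) (i : ι) : Fin d → ℝ := fun j => (S.ray i j : ℝ)

/-- The convex cone spanned by the rays with index in `σ`. -/
def cone (S : StackyFan d ι) (σ : Finset ι) : Set (Fin d → ℝ) :=
  {x | ∃ c : ι → ℝ, (∀ i, 0 ≤ c i) ∧ (∀ i, i ∉ σ → c i = 0) ∧ x = ∑ i, c i • S.realRay i}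

/-- The simplicial fan axioms, for fans whose rays span the ambient space. -/
structure IsFan (S : StackyFan d ι) : Prop where
  down_closed : ∀ σ ∈ S.cones, ∀ τ ⊆ σ, τ ∈ S.cones
  ray_mem : ∀ i, {i} ∈ S.cones
  linearIndepOn : ∀ σ ∈ S.cones, LinearIndepOn ℝ S.realRay (σ : Set ι)
  inter : ∀ σ ∈ S.cones, ∀ τ ∈ S.cones, S.cone σ ∩ S.cone τ = S.cone (σ ∩ τ)
  span : Submodule.span ℝ (Set.range S.realRay) = ⊤

/-- The irrelevant ideal in the Cox ring: it is generated by the products, for the cones `σ`, of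
the variables that do not belong to `σ`. -/
noncomputable def irrelevantIdeal (S : StackyFan d ι) : Ideal (MvPolynomial ι ℂ) :=
  Ideal.span {p | ∃ σ ∈ S.cones, p = ∏ i ∈ σᶜ, X i}

/-- The group of the quotient construction: all `t ∈ (ℂ^*)^ι` with
`∏ i, t_i ^ ⟨e_j, ray i⟩ = 1` for every `j`. -/
def coxGroup (S : StackyFan d ι) : Subgroup (ι → ℂˣ) where
  carrier := {t | ∀ j, ∏ i, t i ^ S.ray i j = 1}
  one_mem' := by simp
  mul_mem' := by
    intro s t hs ht j
    simp only [Pi.mul_apply, mul_zpow, Finset.prod_mul_distrib, hs j, ht j, mul_one]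
  inv_mem' := by
    intro s hs j
    simp only [Pi.inv_apply, inv_zpow, Finset.prod_inv_distrib, hs j, inv_one]

/-- The star subdivision at the lattice vector `γ`. The new ray has the index `none`. The cones
are the old cones that do not contain `γ`, and the cones spanned by `γ` and by a cone `τ` that does
not contain `γ` but is a face of a cone that contains `γ`. -/
def starSubdivision (S : StackyFan d ι) (γ : Fin d → ℤ) : StackyFan d (Option ι) where
  ray v := v.elim γ S.ray
  cones :=
    {ρ | ∃ σ ∈ S.cones, (fun j => (γ j : ℝ)) ∉ S.cone σ ∧
      ρ = σ.map Function.Embedding.some} ∪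
    {ρ | ∃ τ ∈ S.cones, (fun j => (γ j : ℝ)) ∉ S.cone τ ∧
      (∃ σ ∈ S.cones, τ ⊆ σ ∧ (fun j => (γ j : ℝ)) ∈ S.cone σ) ∧ ρ = Finset.insertNone τ}

end StackyFan

/-! ### Weighted blow ups of cyclic quotient singularities -/

/-- The group `μ_r` acting on `ℂ^δ` by `ε · z_i = ε ^ c_i z_i`. -/
def cyclicGroup {δ : Type} (r : ℕ) (c : δ → ℕ) : Subgroup (δ → ℂˣ) where
  carrier := {s | ∃ ε ∈ rootsOfUnity r ℂ, ∀ i, s i = ε ^ c i}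
  one_mem' := ⟨1, one_mem _, by simp⟩
  mul_mem' := by
    rintro s s' ⟨ε, hε, h⟩ ⟨ε', hε', h'⟩
    exact ⟨ε * ε', mul_mem hε hε', fun i => by simp [h, h', mul_pow]⟩
  inv_mem' := by
    rintro s ⟨ε, hε, h⟩
    exact ⟨ε⁻¹, inv_mem hε, fun i => by simp [h]⟩

/-- The cyclic quotient singularity `ℂ^δ / μ_r` of type `(1/r)(c_i)_i`. -/
noncomputable abbrev cyclicQuotient {δ : Type} (r : ℕ) (c : δ → ℕ) : SpaceWithFunctions :=
  quotientSpace (⊤ : Ideal (MvPolynomial δ ℂ)) (cyclicGroup r c)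

/-- Every point of `ℂ^δ` defines a point of `ℂ^δ / μ_r`. -/
noncomputable def cyclicQuotient.mk {δ : Type} {r : ℕ} {c : δ → ℕ} (z : δ → ℂ) : cyclicQuotient r c :=
  quotientSpace.mk z (by simp [stableLocus, zeroLocus_top])

/-- The group `ℂ^* × μ_r` acting on `ℂ^δ × ℂ`, whose last coordinate has the index `none`, by
`(t, ε) · (z_i, u) = (t ^ b_i ε ^ c_i z_i, t⁻¹ u)`. -/
def weightedBlowUpGroup {δ : Type} (r : ℕ) (c b : δ → ℕ) : Subgroup (Option δ → ℂˣ) where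
  carrier := {s | ∃ t : ℂˣ, ∃ ε ∈ rootsOfUnity r ℂ,
    (∀ i, s (some i) = t ^ b i * ε ^ c i) ∧ s none = t⁻¹}
  one_mem' := ⟨1, 1, one_mem _, by simp⟩
  mul_mem' := by
    rintro s s' ⟨t, ε, hε, h, h0⟩ ⟨t', ε', hε', h', h0'⟩
    refine ⟨t * t', ε * ε', mul_mem hε hε', fun i => ?_, ?_⟩
    · simp only [Pi.mul_apply, h, h', mul_pow]
      exact mul_mul_mul_comm _ _ _ _
    · simp only [Pi.mul_apply, h0, h0', mul_inv]
  inv_mem' := by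
    rintro s ⟨t, ε, hε, h, h0⟩
    exact ⟨t⁻¹, ε⁻¹, inv_mem hε, fun i => by simp [h, mul_comm], by simp [h0]⟩

/-- The weighted blow up of `ℂ^δ / μ_r` at the origin with weights `(1/r)(b_i)_i`. The weighted
blow up of `ℂ^δ` with weights `b` is `((ℂ^δ - 0) × ℂ) / ℂ^*` with its map
`(z_i, u) ↦ (u ^ b_i z_i)` to `ℂ^δ`, and `μ_r` acts on it by `ε · (z_i, u) = (ε ^ c_i z_i, u)`. The
weighted blow up of `ℂ^δ / μ_r` is the quotient by this action. -/
noncomputable abbrev weightedBlowUp {δ : Type} (r : ℕ) (c b : δ → ℕ) : SpaceWithFunctions :=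
  quotientSpace (Ideal.span (Set.range fun i : δ => (X (some i) : MvPolynomial (Option δ) ℂ)))
    (weightedBlowUpGroup r c b)

/-- `π : Y → X` is the weighted blow up of `X` at the point `p` with weights `(1/r)(b_i)_i` in the
orbifold coordinates that are given by the chart `φ : ℂ^δ / μ_r → X` centred at `p`. -/
structure IsWeightedBlowUp {Y X : SpaceWithFunctions} (π : Y → X) (p : X) {δ : Type} {r : ℕ}
    {c : δ → ℕ} (φ : cyclicQuotient r c → X) (b : δ → ℕ) : Prop where
  /-- The chart is an isomorphism onto an open neighbourhood of `p`, and maps `0` to `p`. -/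
  chart : IsOpenImmersionOn φ Set.univ
  chart_zero : φ (cyclicQuotient.mk 0) = p
  /-- The weights are positive, and `(1/r) b` lies in the lattice generated by `ℤ^δ` and
  `(1/r) c`. -/
  weight_pos : ∀ i, 0 < b i
  weight_mem : ∃ j : ℕ, ∀ i, b i ≡ j * c i [MOD r]
  /-- `π` is a morphism and an isomorphism over the complement of `p`. -/
  iso_off : IsOpenImmersionOn π (π ⁻¹' {p}ᶜ)
  surjective : Function.Surjective π
  /-- Over the chart, `π` is the weighted blow up of `ℂ^δ / μ_r`. -/
  model : ∃ ψ : weightedBlowUp r c b → Y, IsOpenImmersionOn ψ Set.univ ∧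
    Set.range ψ = π ⁻¹' Set.range φ ∧
    ∀ w hw, π (ψ (quotientSpace.mk w hw)) =
      φ (cyclicQuotient.mk fun i => w none ^ b i * w (some i))

/-! ### Weighted bundles over the projective line, and the rank 3 toric stack -/

/-- The variables `x_0, x_1` (left) and `y_0, …, y_m` (right). -/
abbrev BundleVar (m : ℕ) : Type := Fin 2 ⊕ Fin (m + 1)

/-- The variables `X_0, X_1, Y_0, …, Y_m` (as `some`) and `ξ` (as `none`). -/
abbrev BlowUpVar (m : ℕ) : Type := Option (BundleVar m)

/-- The weighted projective space `ℙ(a_0, …, a_m)` is well-formed. -/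
def WellFormed {m : ℕ} (a : Fin (m + 1) → ℕ) : Prop :=
  ∀ i, (Finset.univ.erase i).gcd a = 1

/-- The weighted bundle over `ℙ^1` with irrelevant ideal `(x_0, x_1) ∩ (y_0, …, y_m)` and weights
`(1, 1, -ω_0, …, -ω_m)` and `(0, 0, a_0, …, a_m)`. -/
noncomputable def weightedBundle {m : ℕ} (ω a : Fin (m + 1) → ℕ) :
    ToricStack (BundleVar m) 2 where
  irrelevantIdeal := Ideal.span {X (Sum.inl 0), X (Sum.inl 1)} ⊓
    Ideal.span (Set.range fun i => X (Sum.inr i))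
  weights := ![Sum.elim (fun _ => 1) (fun i => -(ω i : ℤ)), Sum.elim (fun _ => 0) (fun i => a i)]

/-- The entries `(b_k, 0, b_0, …, b_{k-1}, 0, b_{k+1}, …, b_m)`. -/
def blowUpWeight {m : ℕ} (k : Fin (m + 1)) (b : Fin (m + 1) → ℕ) : BundleVar m → ℕ :=
  Sum.elim ![b k, 0] (fun i => if i = k then 0 else b i)

/-- The rank 3 toric stack with Cox ring `ℂ[X_0, X_1, Y_0, …, Y_m, ξ]`. -/
noncomputable def rankThreeStack {m : ℕ} (ω a : Fin (m + 1) → ℕ) (k : Fin (m + 1))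
    (b : Fin (m + 1) → ℕ) : ToricStack (BlowUpVar m) 3 where
  irrelevantIdeal :=
    Ideal.span {X (some (Sum.inl 0)), X (some (Sum.inl 1))} ⊓
    Ideal.span (Set.range fun i => X (some (Sum.inr i))) ⊓
    Ideal.span {X none, X (some (Sum.inl 1))} ⊓
    Ideal.span {X none, X (some (Sum.inr k))} ⊓
    Ideal.span (insert (X (some (Sum.inl 0))) {p | ∃ i, i ≠ k ∧ p = X (some (Sum.inr i))})
  weights := ![fun v => v.elim 0 ((weightedBundle ω a).weights 0),
    fun v => v.elim 0 ((weightedBundle ω a).weights 1),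
    fun v => v.elim (-(a k : ℤ)) (fun v => (blowUpWeight k b v : ℤ))]

/-- The fan of the weighted bundle in `ℤ^{m+1}`, with standard basis `α_1, β_1, …, β_m` (in this
order), `β_0 = -∑_{i ≥ 1} a_i β_i` and `α_0 = -α_1 + ∑_{i ≥ 0} ω_i β_i`. The maximal cones are
spanned by all rays but one `α_s` and one `β_r`. -/
def bundleFan {m : ℕ} (ω a : Fin (m + 1) → ℕ) : StackyFan (m + 1) (BundleVar m) :=
  let α₁ : Fin (m + 1) → ℤ := Pi.single 0 1
  let β : Fin (m + 1) → Fin (m + 1) → ℤ := fun i =>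
    if i = 0 then -∑ j ∈ Finset.univ.erase 0, (a j : ℤ) • Pi.single j 1 else Pi.single i 1
  { ray := Sum.elim ![-α₁ + ∑ i, (ω i : ℤ) • β i, α₁] β
    cones := {σ | ∃ s r, Sum.inl s ∉ σ ∧ Sum.inr r ∉ σ} }

/-- The point `(0 : 1; 0 : ⋯ : 1 : ⋯ : 0)`, with `y_k = 1`, in homogeneous coordinates. -/
def basePoint {m : ℕ} (k : Fin (m + 1)) : BundleVar m → ℂ :=
  Sum.elim ![0, 1] (Pi.single k 1)

/-- The variables other than `x_1` and `y_k`, the local coordinates at the point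
`(0 : 1; 0 : ⋯ : 1 : ⋯ : 0)`. -/
abbrev ChartVar {m : ℕ} (k : Fin (m + 1)) : Type :=
  {v : BundleVar m // v ≠ Sum.inl 1 ∧ v ≠ Sum.inr k}

/-- The weights of the variables in the second row of the weight matrix: `μ_{a_k}` acts with these
weights on the local coordinates. -/
def chartType {m : ℕ} (a : Fin (m + 1) → ℕ) (k : Fin (m + 1)) : ChartVar k → ℕ :=
  fun v => Sum.elim (fun _ => 0) a v.1

/-- The homogeneous coordinates with `x_1 = y_k = 1` and the other coordinates given by `z`. -/
def chartPoint {m : ℕ} {k : Fin (m + 1)} (z : ChartVar k → ℂ) : BundleVar m → ℂ :=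
  fun v => if h : v ≠ Sum.inl 1 ∧ v ≠ Sum.inr k then z ⟨v, h⟩ else 1

end ToricBlowUp

/-! Everything combinatorial rests on one computation: since $a_0=1$, the linear relations among the
$\alpha_s,\beta_i$, with coefficients in any abelian group, are exactly the combinations of the two
rows of the weight matrix (`bundleFan_sum_smul_eq_zero_iff`). With coefficients in $\mathbb C^*$
this identifies the Cox group. With real coefficients it gives the fan axioms: two nonnegative
representations of a point over cones differ by a relation, and the rays missing from the cones
force both of its parameters to vanish. For the star subdivision, multiplying by $a_k$ and
substituting $a_k\gamma=\sum_v b_v u_v$ turns a relation of the new rays into one of the old rays.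
All ideals are monomial, so they are compared by the supports of exponent vectors.

The map $\pi$ is well defined because two choices of $\zeta=\xi^{1/a_k}$ differ by a root of unity
$\varepsilon$, and the congruences on the $b_i$ make $(\varepsilon^{b_v})_v$ an element of the torus
acting on $\mathcal F$.

For regularity, linear independence of characters shows that a regular function on a quotient is
locally a fraction of two sums of monomials of one common weight
(`quotientSpace.exists_homogeneous`). So a map is a morphism, or an open immersion, as soon as
monomials of equal weight can be rewritten in the other coordinates as polynomials times one common
nonzero factor, which cancels in the fraction; this is the condition `Transfer`. The non-polynomial
factors are powers of $a_k$-th roots, and equality of weights under $\mu_{a_k}$ makes their residual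
exponents agree modulo $a_k$. Normalising $x_1=y_k=1$ by the torus gives the charts `exists_chart`
and `exists_liftedChart`. Off $p$ the inverse of $\pi$ is the section $\xi=1$ (`exists_blowDown`).
-/

namespace ToricBlowUp

/-! ### The Zariski topology on subsets of affine space -/

section Zariski

variable {ι : Type}

/-- Sets on which some polynomial is nonzero form a basis of the Zariski topology. -/
theorem zariskiTopology_isOpen_iff {Z : Set (ι → ℂ)} {V : Set (zariskiSpace Z)} :
    IsOpen V ↔ ∀ z ∈ V, ∃ P : MvPolynomial ι ℂ, eval z.1 P ≠ 0 ∧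
      ∀ w : zariskiSpace Z, eval w.1 P ≠ 0 → w ∈ V := by
  constructor
  · intro h
    change TopologicalSpace.GenerateOpen _ V at h
    induction h with
    | basic s hs =>
      obtain ⟨P, rfl⟩ := hs
      exact fun z hz => ⟨P, hz, fun w hw => hw⟩
    | univ => exact fun z _ => ⟨1, by simp, fun _ _ => trivial⟩
    | inter s t _ _ ihs iht =>
      intro z hz
      obtain ⟨P, hP, hP'⟩ := ihs z hz.1
      obtain ⟨Q, hQ, hQ'⟩ := iht z hz.2
      refine ⟨P * Q, by simp [hP, hQ], fun w hw => ?_⟩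
      rw [map_mul] at hw
      exact ⟨hP' w (left_ne_zero_of_mul hw), hQ' w (right_ne_zero_of_mul hw)⟩
    | sUnion S _ ih =>
      rintro z ⟨s, hs, hz⟩
      obtain ⟨P, hP, hP'⟩ := ih s hs z hz
      exact ⟨P, hP, fun w hw => ⟨s, hs, hP' w hw⟩⟩
  · intro h
    choose! P hP hP' using h
    have : V = ⋃₀ {s | ∃ z ∈ V, s = {w : zariskiSpace Z | eval w.1 (P z) ≠ 0}} := by
      ext w
      constructor
      · exact fun hw => ⟨_, ⟨w, hw, rfl⟩, hP w hw⟩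
      · rintro ⟨_, ⟨z, hz, rfl⟩, hw⟩
        exact hP' z hz w hw
    rw [this]
    refine isOpen_sUnion ?_
    rintro _ ⟨z, _, rfl⟩
    exact TopologicalSpace.GenerateOpen.basic _ ⟨P z, rfl⟩

theorem isOpen_eval_ne_zero {Z : Set (ι → ℂ)} (P : MvPolynomial ι ℂ) :
    IsOpen {w : zariskiSpace Z | eval w.1 P ≠ 0} :=
  zariskiTopology_isOpen_iff.2 fun _ hz => ⟨P, hz, fun _ hw => hw⟩

end Zariski

/-! ### Regular functions on quotients by diagonal groups -/

section Quotient

variable {ι : Type} {I : Ideal (MvPolynomial ι ℂ)} {G : Subgroup (ι → ℂˣ)}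

theorem quotientSpace.mk_eq_mk {z w : ι → ℂ} {hz : z ∈ stableLocus I} {hw : w ∈ stableLocus I} :
    (quotientSpace.mk z hz : quotientSpace I G) = quotientSpace.mk w hw ↔
      ∃ t ∈ G, ∀ i, w i = (t i : ℂ) * z i :=
  Quotient.eq

theorem quotientSpace.ind {p : quotientSpace I G → Prop}
    (h : ∀ z hz, p (quotientSpace.mk z hz)) (x : quotientSpace I G) : p x :=
  Quotient.inductionOn x fun z => h z.1 z.2

theorem quotientSpace.isOpen_iff {V : Set (quotientSpace I G)} :
    IsOpen V ↔ ∀ z hz, quotientSpace.mk z hz ∈ V → ∃ P : MvPolynomial ι ℂ, eval z P ≠ 0 ∧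
      ∀ w hw, eval w P ≠ 0 → quotientSpace.mk w hw ∈ V := by
  change IsOpen ((fun z => quotientSpace.mk z.1 z.2) ⁻¹' V : Set (zariskiSpace (stableLocus I))) ↔ _
  rw [zariskiTopology_isOpen_iff]
  exact ⟨fun h z hz hzV => (h ⟨z, hz⟩ hzV).imp fun P hP => ⟨hP.1, fun w hw => hP.2 ⟨w, hw⟩⟩,
    fun h z hzV => (h z.1 z.2 hzV).imp fun P hP => ⟨hP.1, fun w => hP.2 w.1 w.2⟩⟩

theorem quotientSpace.mem_reg_of {U : Set (quotientSpace I G)} (hU : IsOpen U)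
    {f : quotientSpace I G → ℂ}
    (h : ∀ z hz, quotientSpace.mk z hz ∈ U → ∃ P Q : MvPolynomial ι ℂ, eval z Q ≠ 0 ∧
      ∀ w hw, eval w Q ≠ 0 → f (quotientSpace.mk w hw) = eval w P / eval w Q) :
    f ∈ (quotientSpace I G).reg U := by
  intro z hz
  obtain ⟨P, Q, hQ, hPQ⟩ := h z.1 z.2 hz
  refine ⟨_, (hU.preimage continuous_quotient_mk').inter (isOpen_eval_ne_zero Q), ⟨hz, hQ⟩,
    Set.inter_subset_left, P, Q, fun w hw => ⟨hw.2, hPQ w.1 w.2 hw.2⟩⟩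

/-- A local fraction is multiplied above and below by a polynomial that vanishes off its domain. The
identity between function, numerator and denominator then holds on all of `U`, and both polynomials
vanish off `U`, so it can be evaluated along a whole orbit, which may leave the original
neighbourhood. -/
theorem quotientSpace.exists_of_mem_reg {U : Set (quotientSpace I G)}
    {f : quotientSpace I G → ℂ} (hf : f ∈ (quotientSpace I G).reg U)
    {z : ι → ℂ} (hz : z ∈ stableLocus I) (hzU : quotientSpace.mk z hz ∈ U) :
    ∃ P Q : MvPolynomial ι ℂ, eval z Q ≠ 0 ∧
      (∀ w hw, eval w Q ≠ 0 → quotientSpace.mk w hw ∈ U) ∧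
      (∀ w hw, f (quotientSpace.mk w hw) * eval w Q = eval w P ∨
        (quotientSpace.mk w hw : quotientSpace I G) ∉ U) ∧
      ∀ w hw, (quotientSpace.mk w hw : quotientSpace I G) ∉ U → eval w Q = 0 ∧ eval w P = 0 := by
  obtain ⟨V, hV, hzV, hVU, P, Q, h⟩ := hf ⟨z, hz⟩ hzU
  obtain ⟨R, hR, hRV⟩ := zariskiTopology_isOpen_iff.1 hV _ hzV
  have key : ∀ w (hw : w ∈ stableLocus I), eval w R ≠ 0 → quotientSpace.mk w hw ∈ U :=
    fun w hw hRw => hVU (hRV ⟨w, hw⟩ hRw)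
  refine ⟨R * P, R * Q, by simpa using ⟨hR, (h _ hzV).1⟩, fun w hw h0 => ?_, fun w hw => ?_,
    fun w hw h0 => ?_⟩
  · exact key w hw (by rw [map_mul] at h0; exact left_ne_zero_of_mul h0)
  · by_cases hRw : eval w R = 0
    · simp [hRw]
    · obtain ⟨h1, h2⟩ := h _ (hRV ⟨w, hw⟩ hRw)
      left
      have h2' : f (quotientSpace.mk w hw) = eval w P / eval w Q := h2
      rw [h2', map_mul, map_mul]
      have h1' : eval w Q ≠ 0 := h1
      field_simp
  · have : eval w R = 0 := by
      by_contra hne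
      exact h0 (key w hw hne)
    simp [this]

variable [Fintype ι]

/-- The value at the point `z` of the monomial with exponent vector `d`. -/
noncomputable def monomialValue (z : ι → ℂ) (d : ι →₀ ℕ) : ℂ := ∏ i, z i ^ d i

/-- The weight of the group `G` on the monomial with exponent vector `d`. -/
def monomialChar (G : Subgroup (ι → ℂˣ)) (d : ι →₀ ℕ) : G →* ℂ where
  toFun t := ∏ i, (t.1 i : ℂ) ^ d i
  map_one' := by simp
  map_mul' s t := by simp [mul_pow, Finset.prod_mul_distrib]

/-- The group `G` acts with the same weight on all the monomials in `S`. -/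
def SameWeight (G : Subgroup (ι → ℂˣ)) (S : Finset (ι →₀ ℕ)) : Prop :=
  ∀ d ∈ S, ∀ d' ∈ S, monomialChar G d = monomialChar G d'

theorem monomialValue_smul {t : ι → ℂˣ} (ht : t ∈ G) {z w : ι → ℂ}
    (h : ∀ i, w i = (t i : ℂ) * z i) (d : ι →₀ ℕ) :
    monomialValue w d = monomialChar G d ⟨t, ht⟩ * monomialValue z d := by
  simp only [monomialValue, monomialChar, h, mul_pow, Finset.prod_mul_distrib]
  rfl

theorem monomialChar_ne_zero (d : ι →₀ ℕ) (t : G) : monomialChar G d t ≠ 0 := by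
  simp [monomialChar, Finset.prod_ne_zero_iff]

theorem SameWeight.sum_ne_zero {S : Finset (ι →₀ ℕ)} (hS : SameWeight G S)
    {q : (ι →₀ ℕ) → ℂ} {t : ι → ℂˣ} (ht : t ∈ G) {z w : ι → ℂ} (h : ∀ i, w i = (t i : ℂ) * z i)
    (hz : ∑ d ∈ S, q d * monomialValue z d ≠ 0) : ∑ d ∈ S, q d * monomialValue w d ≠ 0 := by
  obtain ⟨d₀, hd₀⟩ := Finset.nonempty_of_sum_ne_zero hz
  have : ∑ d ∈ S, q d * monomialValue w d =
      monomialChar G d₀ ⟨t, ht⟩ * ∑ d ∈ S, q d * monomialValue z d := by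
    rw [Finset.mul_sum]
    refine Finset.sum_congr rfl fun d hd => ?_
    rw [monomialValue_smul ht h, hS d hd d₀ hd₀]
    ring
  rw [this]
  exact mul_ne_zero (monomialChar_ne_zero _ _) hz

/-- If a sum of multiples of characters vanishes, then so does the part that belongs to any one
character. -/
theorem sum_filter_char_eq_zero {M D : Type*} [Monoid M] [DecidableEq (M →* ℂ)] (S : Finset D)
    (χ : D → M →* ℂ) (c : D → ℂ) (h : ∀ t, ∑ d ∈ S, c d * χ d t = 0) (χ₀ : M →* ℂ) :
    ∑ d ∈ S with χ d = χ₀, c d = 0 := by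
  by_cases hχ : χ₀ ∈ S.image χ
  · refine linearIndependent_iff'.1 (linearIndependent_monoidHom M ℂ) (S.image χ)
      (fun ψ => ∑ d ∈ S with χ d = ψ, c d) ?_ χ₀ hχ
    funext t
    rw [Finset.sum_apply, Pi.zero_apply, ← h t,
      ← Finset.sum_fiberwise_of_maps_to (g := χ) (t := S.image χ)
        (fun d hd => Finset.mem_image_of_mem χ hd)]
    refine Finset.sum_congr rfl fun ψ _ => ?_
    rw [Pi.smul_apply, smul_eq_mul, Finset.sum_mul]
    refine Finset.sum_congr rfl fun d hd => ?_
    rw [(Finset.mem_filter.1 hd).2]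
  · refine Finset.sum_eq_zero fun d hd => ?_
    rw [Finset.mem_filter] at hd
    exact absurd (hd.2 ▸ Finset.mem_image_of_mem χ hd.1) hχ

/-- A regular function on a quotient is locally a quotient of two homogeneous polynomials of the
same weight. -/
theorem quotientSpace.exists_homogeneous
    (hI : ∀ z ∈ stableLocus I, ∀ t : ι → ℂˣ, (fun i => (t i : ℂ) * z i) ∈ stableLocus I)
    {U : Set (quotientSpace I G)} {f : quotientSpace I G → ℂ}
    (hf : f ∈ (quotientSpace I G).reg U) {w : ι → ℂ} (hw : w ∈ stableLocus I)
    (hwU : quotientSpace.mk w hw ∈ U) :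
    ∃ (S : Finset (ι →₀ ℕ)) (p q : (ι →₀ ℕ) → ℂ), SameWeight G S ∧
      ∑ d ∈ S, q d * monomialValue w d ≠ 0 ∧
      ∀ z hz, ∑ d ∈ S, q d * monomialValue z d ≠ 0 → quotientSpace.mk z hz ∈ U ∧
        f (quotientSpace.mk z hz) * ∑ d ∈ S, q d * monomialValue z d =
          ∑ d ∈ S, p d * monomialValue z d := by
  classical
  obtain ⟨P, Q, hQw, hQU, hPQ, hout⟩ := quotientSpace.exists_of_mem_reg hf hw hwU
  set S₀ := P.support ∪ Q.support
  have eP : ∀ z, eval z P = ∑ d ∈ S₀, P.coeff d * monomialValue z d := fun z => by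
    rw [eval_eq']
    exact Finset.sum_subset Finset.subset_union_left fun d _ hd => by
      rw [notMem_support_iff.1 hd, zero_mul]
  have eQ : ∀ z, eval z Q = ∑ d ∈ S₀, Q.coeff d * monomialValue z d := fun z => by
    rw [eval_eq']
    exact Finset.sum_subset Finset.subset_union_right fun d _ hd => by
      rw [notMem_support_iff.1 hd, zero_mul]
  -- The isotypic parts of $Q$ add up to $Q(w)\neq0$, so one of them is nonzero at $w$; the same
  -- character is then used for $P$.
  obtain ⟨χ₀, hχ₀⟩ : ∃ χ₀ : G →* ℂ,
      ∑ d ∈ S₀ with monomialChar G d = χ₀, Q.coeff d * monomialValue w d ≠ 0 := by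
    by_contra! hcon
    apply hQw
    rw [eQ, ← Finset.sum_fiberwise_of_maps_to (g := monomialChar G) (t := S₀.image (monomialChar G))
        (fun d hd => Finset.mem_image_of_mem _ hd)]
    exact Finset.sum_eq_zero fun χ _ => hcon χ
  have orbit : ∀ z hz (t : G), ∃ h : (fun i => (t.1 i : ℂ) * z i) ∈ stableLocus I,
      (quotientSpace.mk _ h : quotientSpace I G) = quotientSpace.mk z hz := fun z hz t =>
    ⟨hI z hz t.1, (quotientSpace.mk_eq_mk.2 ⟨t.1, t.2, fun _ => rfl⟩).symm⟩
  -- A polynomial that vanishes on the orbit of $z$ has every isotypic part zero at $z$.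
  have component : ∀ (c : (ι →₀ ℕ) → ℂ) (z : ι → ℂ),
      (∀ t : G, ∑ d ∈ S₀, c d * monomialValue (fun i => (t.1 i : ℂ) * z i) d = 0) →
      ∑ d ∈ S₀ with monomialChar G d = χ₀, c d * monomialValue z d = 0 := fun c z h => by
    refine sum_filter_char_eq_zero S₀ (monomialChar G) _ (fun t => ?_) χ₀
    rw [← h t]
    refine Finset.sum_congr rfl fun d _ => ?_
    rw [monomialValue_smul t.2 (fun _ => rfl)]
    ring
  refine ⟨S₀.filter fun d => monomialChar G d = χ₀, P.coeff, Q.coeff, ?_, hχ₀, fun z hz hne => ?_⟩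
  · intro d hd d' hd'
    rw [(Finset.mem_filter.1 hd).2, (Finset.mem_filter.1 hd').2]
  have hzU : quotientSpace.mk z hz ∈ U := by
    by_contra hzU
    refine hne (component Q.coeff z fun t => ?_)
    obtain ⟨h1, h2⟩ := orbit z hz t
    rw [← eQ]
    exact (hout _ h1 (by rwa [h2])).1
  refine ⟨hzU, ?_⟩
  rw [← sub_eq_zero, Finset.mul_sum, ← Finset.sum_sub_distrib]
  -- $f$ is constant on the orbit of $z$, so $f(z)Q-P$ vanishes along it.
  have := component (fun d => f (quotientSpace.mk z hz) * Q.coeff d - P.coeff d) z fun t => by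
    obtain ⟨h1, h2⟩ := orbit z hz t
    simp only [sub_mul, Finset.sum_sub_distrib, mul_assoc, ← Finset.mul_sum]
    rw [← eQ, ← eP, sub_eq_zero]
    have := (hPQ _ h1).resolve_right (by rw [h2]; exact not_not.2 hzU)
    rwa [h2] at this
  rw [← this]
  exact Finset.sum_congr rfl fun d _ => by ring

end Quotient

/-! ### A criterion for morphisms and open immersions of quotients -/

section Transfer

variable {ι ι' : Type} [Fintype ι] [Fintype ι'] {I : Ideal (MvPolynomial ι ℂ)}
  {G : Subgroup (ι → ℂˣ)} {I' : Ideal (MvPolynomial ι' ℂ)} {G' : Subgroup (ι' → ℂˣ)}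

/-- Homogeneous fractions on `(ℂ^ι - V(I)) / G` can be rewritten locally as fractions in the
coordinates of `ℂ^ι'`, along the relation `R` between points. -/
def Transfer (I : Ideal (MvPolynomial ι ℂ)) (G : Subgroup (ι → ℂˣ))
    (I' : Ideal (MvPolynomial ι' ℂ)) (R : (ι → ℂ) → (ι' → ℂ) → Prop) : Prop :=
  ∀ S : Finset (ι →₀ ℕ), SameWeight G S → ∀ w ∈ stableLocus I, ∀ w' ∈ stableLocus I', R w w' →
    (∃ d ∈ S, monomialValue w d ≠ 0) →
    ∃ (N : MvPolynomial ι' ℂ) (E : (ι →₀ ℕ) → MvPolynomial ι' ℂ), eval w' N ≠ 0 ∧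
      ∀ z' ∈ stableLocus I', eval z' N ≠ 0 → ∃ z ∈ stableLocus I, R z z' ∧
        ∃ μ : ℂ, μ ≠ 0 ∧ ∀ d ∈ S, monomialValue z d = μ * eval z' (E d)

omit [Fintype ι'] in
-- The factor $\mu$ depends on the point but not on the monomial, so it cancels between numerator
-- and denominator. Multiplying both by `N` confines the fraction to the set where the rewriting is
-- valid.
theorem Transfer.exists_fraction {R : (ι → ℂ) → (ι' → ℂ) → Prop} (hR : Transfer I G I' R)
    (hI : ∀ z ∈ stableLocus I, ∀ t : ι → ℂˣ, (fun i => (t i : ℂ) * z i) ∈ stableLocus I)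
    (hRG : ∀ z w z', R z z' → R w z' → ∃ t ∈ G, ∀ i, w i = (t i : ℂ) * z i)
    {U : Set (quotientSpace I G)} {f : quotientSpace I G → ℂ}
    (hf : f ∈ (quotientSpace I G).reg U) {w : ι → ℂ} (hw : w ∈ stableLocus I)
    (hwU : quotientSpace.mk w hw ∈ U) {w' : ι' → ℂ} (hw' : w' ∈ stableLocus I') (hww : R w w') :
    ∃ P Q : MvPolynomial ι' ℂ, eval w' Q ≠ 0 ∧ ∀ z' ∈ stableLocus I', eval z' Q ≠ 0 →
      ∃ z hz, R z z' ∧ quotientSpace.mk z hz ∈ U ∧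
        f (quotientSpace.mk z hz) = eval z' P / eval z' Q := by
  obtain ⟨S, p, q, hS, hq, h⟩ := quotientSpace.exists_homogeneous hI hf hw hwU
  obtain ⟨N, E, hN, hE⟩ := hR S hS w hw w' hw' hww (by
    obtain ⟨d, hd, h0⟩ := Finset.exists_ne_zero_of_sum_ne_zero hq
    exact ⟨d, hd, right_ne_zero_of_mul h0⟩)
  have ev : ∀ (c : (ι →₀ ℕ) → ℂ) (z' : ι' → ℂ) (z : ι → ℂ) (μ : ℂ),
      (∀ d ∈ S, monomialValue z d = μ * eval z' (E d)) →
      ∑ d ∈ S, c d * monomialValue z d = μ * eval z' (∑ d ∈ S, C (c d) * E d) := by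
    intro c z' z μ h
    rw [map_sum, Finset.mul_sum]
    refine Finset.sum_congr rfl fun d hd => ?_
    rw [h d hd, map_mul, eval_C]
    ring
  refine ⟨N * ∑ d ∈ S, C (p d) * E d, N * ∑ d ∈ S, C (q d) * E d, ?_, fun z' hz' hne => ?_⟩
  · rw [map_mul]
    refine mul_ne_zero hN fun h0 => ?_
    -- The point supplied over $w'$ need not be $w$, but it lies in the same orbit, and nonvanishing
    -- of a homogeneous sum is invariant along orbits.
    obtain ⟨z, hz, hzw, μ, hμ, hd⟩ := hE w' hw' hN
    obtain ⟨t, ht, hzt⟩ := hRG _ _ _ hww hzw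
    have := hS.sum_ne_zero ht hzt hq
    rw [ev q w' z μ hd, h0, mul_zero] at this
    exact this rfl
  · rw [map_mul] at hne
    obtain ⟨z, hz, hzw, μ, hμ, hd⟩ := hE z' hz' (left_ne_zero_of_mul hne)
    have h2 := ev q z' z μ hd
    have hne' : ∑ d ∈ S, q d * monomialValue z d ≠ 0 := by
      rw [h2]
      exact mul_ne_zero hμ (right_ne_zero_of_mul hne)
    obtain ⟨h3, h4⟩ := h z hz hne'
    refine ⟨z, hz, hzw, h3, ?_⟩
    rw [map_mul, map_mul, eq_div_iff hne]
    rw [h2, ev p z' z μ hd] at h4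
    apply mul_left_cancel₀ hμ
    linear_combination (eval z' N) * h4

omit [Fintype ι] in
theorem isMorphism_of_transfer {f : quotientSpace I G → quotientSpace I' G'}
    (hI' : ∀ z ∈ stableLocus I', ∀ t : ι' → ℂˣ, (fun i => (t i : ℂ) * z i) ∈ stableLocus I')
    (h : Transfer I' G' I fun z' z => ∃ hz hz', f (quotientSpace.mk z hz) = quotientSpace.mk z' hz') :
    IsMorphism f := by
  have hRG : ∀ z' w' z, (∃ hz hz', f (quotientSpace.mk z hz) = quotientSpace.mk z' hz') →
      (∃ hz hz', f (quotientSpace.mk z hz) = quotientSpace.mk w' hz') →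
      ∃ t ∈ G', ∀ i, w' i = (t i : ℂ) * z' i := by
    rintro z' w' z ⟨hz, hz', h1⟩ ⟨_, hw', h2⟩
    exact quotientSpace.mk_eq_mk.1 (h1.symm.trans h2)
  have rep : ∀ z hz, ∃ z', ∃ hz', f (quotientSpace.mk z hz) = quotientSpace.mk z' hz' := fun z hz =>
    quotientSpace.ind (p := fun x => ∃ z', ∃ hz', x = quotientSpace.mk z' hz')
      (fun z' hz' => ⟨z', hz', rfl⟩) _
  have cont : ∀ V : Set (quotientSpace I' G'), IsOpen V → IsOpen (f ⁻¹' V) := by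
    intro V hV
    rw [quotientSpace.isOpen_iff]
    intro w hw hwV
    obtain ⟨w', hw', e⟩ := rep w hw
    have hwV' : f (quotientSpace.mk w hw) ∈ V := hwV
    -- Continuity comes from applying the fraction lemma to the function $0$ on $V$: only the
    -- neighbourhood $Q\neq0$ is kept.
    obtain ⟨P, Q, hQ, hPQ⟩ := h.exists_fraction hI' hRG
      ((quotientSpace I' G').const_mem V hV 0) hw' (e ▸ hwV') hw ⟨hw, hw', e⟩
    refine ⟨Q, hQ, fun z hz hzQ => ?_⟩
    obtain ⟨z', hz', ⟨_, _, e'⟩, hV', -⟩ := hPQ z hz hzQ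
    rw [← e'] at hV'
    exact hV'
  refine ⟨continuous_def.2 cont, fun V hV g hg => ?_⟩
  refine quotientSpace.mem_reg_of (cont V hV) fun w hw hwV => ?_
  obtain ⟨w', hw', e⟩ := rep w hw
  have hwV' : f (quotientSpace.mk w hw) ∈ V := hwV
  obtain ⟨P, Q, hQ, hPQ⟩ := h.exists_fraction hI' hRG hg hw' (e ▸ hwV') hw ⟨hw, hw', e⟩
  refine ⟨P, Q, hQ, fun z hz hzQ => ?_⟩
  obtain ⟨z', hz', ⟨_, _, e'⟩, -, h2⟩ := hPQ z hz hzQ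
  rw [Function.comp_apply, e', h2]

omit [Fintype ι'] in
-- Here the transfer runs from source to target, so it describes functions pushed forward along $f$.
-- Injectivity on `W` makes the lift of a point unique up to the group. Openness of images again
-- comes from the zero function.
theorem isOpenImmersionOn_of_transfer {f : quotientSpace I G → quotientSpace I' G'}
    {W : Set (quotientSpace I G)}
    (hI : ∀ z ∈ stableLocus I, ∀ t : ι → ℂˣ, (fun i => (t i : ℂ) * z i) ∈ stableLocus I)
    (hf : IsMorphism f) (hW : IsOpen W) (hinj : Set.InjOn f W)
    (h : Transfer I G I' fun z z' => ∃ hz hz', quotientSpace.mk z hz ∈ W ∧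
      f (quotientSpace.mk z hz) = quotientSpace.mk z' hz') :
    IsOpenImmersionOn f W := by
  have hRG : ∀ z w z', (∃ hz hz', quotientSpace.mk z hz ∈ W ∧
        f (quotientSpace.mk z hz) = quotientSpace.mk z' hz') →
      (∃ hw hz', quotientSpace.mk w hw ∈ W ∧
        f (quotientSpace.mk w hw) = quotientSpace.mk z' hz') →
      ∃ t ∈ G, ∀ i, w i = (t i : ℂ) * z i := by
    rintro z w z' ⟨hz, hz', hzW, h1⟩ ⟨hw, _, hwW, h2⟩
    exact quotientSpace.mk_eq_mk.1 (hinj hzW hwW (h1.trans h2.symm))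
  have lift : ∀ V ⊆ W, ∀ x ∈ f '' V, ∀ w' hw', x = quotientSpace.mk w' hw' →
      ∃ w hw, quotientSpace.mk w hw ∈ V ∧ quotientSpace.mk w hw ∈ W ∧
        f (quotientSpace.mk w hw) = quotientSpace.mk w' hw' := by
    rintro V hVW _ ⟨y, hy, rfl⟩ w' hw' e
    induction y using quotientSpace.ind with
    | h w hw => exact ⟨w, hw, hy, hVW hy, e⟩
  refine ⟨hf, hW, hinj, fun V hV hVW => ?_⟩
  have hopen : IsOpen (f '' V) := by
    rw [quotientSpace.isOpen_iff]
    intro w' hw' hx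
    obtain ⟨w, hw, hwV, hwW, e⟩ := lift V hVW _ hx w' hw' rfl
    obtain ⟨P, Q, hQ, hPQ⟩ := h.exists_fraction hI hRG
      ((quotientSpace I G).const_mem V hV 0) hw hwV hw' ⟨hw, hw', hwW, e⟩
    refine ⟨Q, hQ, fun z' hz' hzQ => ?_⟩
    obtain ⟨z, hz, ⟨_, _, _, e'⟩, hV', -⟩ := hPQ z' hz' hzQ
    exact ⟨_, hV', e'⟩
  refine ⟨hopen, fun g hg => ?_⟩
  classical
  have hext : ∀ x : quotientSpace I' G', ∃ c : ℂ, ∀ y ∈ V, f y = x → c = g y := by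
    intro x
    by_cases hx : x ∈ f '' V
    · obtain ⟨y, hy, rfl⟩ := hx
      exact ⟨g y, fun y' hy' e => by rw [hinj (hVW hy') (hVW hy) e]⟩
    · exact ⟨0, fun y hy e => absurd ⟨y, hy, e⟩ hx⟩
  choose k hk using hext
  refine ⟨k, quotientSpace.mem_reg_of hopen fun w' hw' hx => ?_, fun x hx => hk _ x hx rfl⟩
  obtain ⟨w, hw, hwV, hwW, e⟩ := lift V hVW _ hx w' hw' rfl
  obtain ⟨P, Q, hQ, hPQ⟩ := h.exists_fraction hI hRG hg hw hwV hw' ⟨hw, hw', hwW, e⟩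
  refine ⟨P, Q, hQ, fun z' hz' hzQ => ?_⟩
  obtain ⟨z, hz, ⟨_, _, _, e'⟩, hV', h2⟩ := hPQ z' hz' hzQ
  rw [← h2]
  exact hk _ _ hV' e'

omit [Fintype ι] in
/-- A map that is given by polynomials in the homogeneous coordinates is a morphism. -/
theorem isMorphism_of_polynomial {f : quotientSpace I G → quotientSpace I' G'}
    (hI' : ∀ z ∈ stableLocus I', ∀ t : ι' → ℂˣ, (fun i => (t i : ℂ) * z i) ∈ stableLocus I')
    (s : ι' → MvPolynomial ι ℂ)
    (h : ∀ z hz, ∃ hz', f (quotientSpace.mk z hz) = quotientSpace.mk (fun i => eval z (s i)) hz') :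
    IsMorphism f := by
  refine isMorphism_of_transfer hI' fun S _ w' _ w _ _ _ =>
    ⟨1, fun d => ∏ i, s i ^ d i, by simp, fun z hz _ => ?_⟩
  obtain ⟨hz', e⟩ := h z hz
  exact ⟨_, hz', ⟨hz, hz', e⟩, 1, one_ne_zero, fun d _ => by simp [monomialValue]⟩

end Transfer

/-! ### Simplicial fans and their irrelevant ideals -/

namespace StackyFan

variable {d : ℕ} {ι : Type} [Fintype ι] [DecidableEq ι]

/-- A collection of cones is a simplicial fan if a point is a nonnegative combination of the rays
of a cone in at most one way. -/
theorem isFan_of_unique {S : StackyFan d ι} (down_closed : ∀ σ ∈ S.cones, ∀ τ ⊆ σ, τ ∈ S.cones)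
    (ray_mem : ∀ i, {i} ∈ S.cones) (span : Submodule.span ℝ (Set.range S.realRay) = ⊤)
    (unique : ∀ σ ∈ S.cones, ∀ τ ∈ S.cones, ∀ c e : ι → ℝ, (∀ i, 0 ≤ c i) → (∀ i, 0 ≤ e i) →
      (∀ i, i ∉ σ → c i = 0) → (∀ i, i ∉ τ → e i = 0) →
      ∑ i, c i • S.realRay i = ∑ i, e i • S.realRay i → c = e) : S.IsFan where
  down_closed := down_closed
  ray_mem := ray_mem
  span := span
  linearIndepOn σ hσ := by
    rw [linearIndepOn_iff']
    intro t g ht hg i hi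
    -- The positive and negative parts of a linear relation supported in $\sigma$ represent the same
    -- point, so they agree; being disjointly supported, both vanish.
    have key : (fun i => if i ∈ t then max (g i) 0 else 0) =
        fun i => if i ∈ t then max (-g i) 0 else 0 := by
      refine unique σ hσ σ hσ _ _ (fun i => ?_) (fun i => ?_) (fun i hi => ?_) (fun i hi => ?_) ?_
      · split_ifs <;> simp
      · split_ifs <;> simp
      · exact if_neg fun h => hi (ht h)
      · exact if_neg fun h => hi (ht h)
      · rw [← sub_eq_zero, ← Finset.sum_sub_distrib]
        rw [← Finset.sum_subset (Finset.subset_univ t) fun i _ hi => by simp [hi], ← hg]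
        refine Finset.sum_congr rfl fun i hi => ?_
        rw [if_pos hi, if_pos hi, ← sub_smul]
        congr 1
        rcases le_total (g i) 0 with h | h <;> simp [h]
    have := congrFun key i
    simp only [hi, if_true] at this
    rcases le_total (g i) 0 with h | h
    · rw [max_eq_right h, max_eq_left (by linarith)] at this
      linarith
    · rw [max_eq_left h, max_eq_right (by linarith)] at this
      linarith
  inter σ hσ τ hτ := by
    ext x
    constructor
    · rintro ⟨⟨c, hc, hcσ, rfl⟩, ⟨e, he, heτ, hx⟩⟩
      have := unique σ hσ τ hτ c e hc he hcσ heτ hx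
      subst this
      refine ⟨c, hc, fun i hi => ?_, rfl⟩
      rw [Finset.mem_inter, not_and_or] at hi
      exact hi.elim (hcσ i) (heτ i)
    · rintro ⟨c, hc, h, rfl⟩
      exact ⟨⟨c, hc, fun i hi => h i fun h' => hi (Finset.mem_inter.1 h').1, rfl⟩,
        ⟨c, hc, fun i hi => h i fun h' => hi (Finset.mem_inter.1 h').2, rfl⟩⟩

/-- The ideal is monomial, so membership is tested on each exponent vector: some cone must contain
all rays with exponent zero. -/
theorem mem_irrelevantIdeal_iff {S : StackyFan d ι} {p : MvPolynomial ι ℂ} :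
    p ∈ S.irrelevantIdeal ↔ ∀ n ∈ p.support, ∃ σ ∈ S.cones, ∀ i, i ∉ σ → n i ≠ 0 := by
  have : {p : MvPolynomial ι ℂ | ∃ σ ∈ S.cones, p = ∏ i ∈ σᶜ, X i} =
      (fun s => monomial s (1 : ℂ)) ''
        ((fun σ : Finset ι => ∑ i ∈ σᶜ, Finsupp.single i 1) '' S.cones) := by
    ext p
    simp only [Set.mem_ofPred_eq, Set.mem_image, exists_exists_and_eq_and]
    refine exists_congr fun σ => and_congr_right fun _ => ?_
    rw [monomial_sum_one, eq_comm]
    rfl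
  rw [irrelevantIdeal, this, mem_ideal_span_monomial_image]
  refine forall₂_congr fun n _ => ?_
  rw [Set.exists_mem_image]
  refine exists_congr fun σ => and_congr_right fun _ => ?_
  rw [Finsupp.le_def]
  refine forall_congr' fun i => ?_
  rw [Finsupp.finsetSum_apply]
  simp only [Finsupp.single_apply, Finset.sum_ite_eq', Finset.mem_compl]
  by_cases h : i ∈ σ <;> simp [h, Nat.one_le_iff_ne_zero]

omit [DecidableEq ι] in
theorem sum_smul_realRay_apply (S : StackyFan d ι) (c : ι → ℝ) (j : Fin d) :
    (∑ i, c i • S.realRay i) j = ∑ i, S.ray i j • c i := by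
  simp [realRay, mul_comm]

end StackyFan

/-! ### The fan of the weighted bundle -/

section BundleFan

variable {m : ℕ} {ω a : Fin (m + 1) → ℕ}

theorem bundleFan_ray_inl_zero (j : Fin (m + 1)) :
    (bundleFan ω a).ray (Sum.inl 0) j = if j = 0 then -1 else (ω j : ℤ) - ω 0 * a j := by
  have key : (∑ i, (ω i : ℤ) • (if i = 0 then
      -∑ j ∈ Finset.univ.erase 0, (a j : ℤ) • (Pi.single j 1 : Fin (m + 1) → ℤ)
      else Pi.single i 1)) j = if j = 0 then 0 else (ω j : ℤ) - ω 0 * a j := by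
    have : ∀ i ∈ Finset.univ.erase (0 : Fin (m + 1)), ((ω i : ℤ) • (if i = 0 then
        -∑ j ∈ Finset.univ.erase 0, (a j : ℤ) • (Pi.single j 1 : Fin (m + 1) → ℤ)
        else Pi.single i 1)) j = if j = i then (ω i : ℤ) else 0 := fun i hi => by
      simp [Finset.ne_of_mem_erase hi, Pi.single_apply]
    rw [Finset.sum_apply, ← Finset.add_sum_erase _ _ (Finset.mem_univ 0),
      Finset.sum_congr rfl this, Finset.sum_ite_eq]
    by_cases hj : j = 0
    · simp [hj, Finset.sum_apply, Pi.single_apply]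
    · simp [hj, Finset.sum_apply, Pi.single_apply]
      ring
  simp only [bundleFan, Sum.elim_inl, Matrix.cons_val_zero, Pi.add_apply, Pi.neg_apply, key]
  split_ifs with h <;> simp [h]

theorem bundleFan_ray_inl_one (j : Fin (m + 1)) :
    (bundleFan ω a).ray (Sum.inl 1) j = if j = 0 then 1 else 0 := by
  simp [bundleFan, Pi.single_apply]

theorem bundleFan_ray_inr (i j : Fin (m + 1)) :
    (bundleFan ω a).ray (Sum.inr i) j =
      if i = 0 then (if j = 0 then 0 else -(a j : ℤ)) else if j = i then 1 else 0 := by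
  by_cases hi : i = 0
  · by_cases hj : j = 0 <;> simp [bundleFan, hi, hj, Finset.sum_apply, Pi.single_apply]
  · simp [bundleFan, hi, Pi.single_apply]

/-- General coefficients serve three purposes: $\mathbb R$ for cones, $\mathbb Z$ for the
construction of $\gamma$, and $\mathbb C^*$ written additively for the Cox group. -/
theorem bundleFan_sum_smul {M : Type*} [AddCommGroup M] (c : BundleVar m → M) (j : Fin (m + 1)) :
    ∑ v, (bundleFan ω a).ray v j • c v = if j = 0 then c (Sum.inl 1) - c (Sum.inl 0) else
      ((ω j : ℤ) - ω 0 * a j) • c (Sum.inl 0) - (a j : ℤ) • c (Sum.inr 0) + c (Sum.inr j) := by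
  rw [Fintype.sum_sum_type, Fin.sum_univ_two, bundleFan_ray_inl_zero, bundleFan_ray_inl_one,
    ← Finset.add_sum_erase _ _ (Finset.mem_univ (0 : Fin (m + 1)))]
  have : ∀ i ∈ Finset.univ.erase (0 : Fin (m + 1)), (bundleFan ω a).ray (Sum.inr i) j •
      c (Sum.inr i) = if j = i then c (Sum.inr i) else 0 := fun i hi => by
    rw [bundleFan_ray_inr, if_neg (Finset.ne_of_mem_erase hi)]
    split_ifs <;> simp
  rw [Finset.sum_congr rfl this, bundleFan_ray_inr, Finset.sum_ite_eq]
  by_cases hj : j = 0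
  · simp [hj, sub_eq_add_neg, add_comm]
  · simp [hj, sub_eq_add_neg]
    abel

/-- The relations among the rays are the combinations of the rows of the weight matrix. -/
theorem bundleFan_sum_smul_eq_zero_iff (ha0 : a 0 = 1) {M : Type*} [AddCommGroup M]
    (c : BundleVar m → M) :
    (∀ j, ∑ v, (bundleFan ω a).ray v j • c v = 0) ↔ ∃ s t : M, (∀ i, c (Sum.inl i) = s) ∧
      ∀ i, c (Sum.inr i) = (a i : ℤ) • t - (ω i : ℤ) • s := by
  simp only [bundleFan_sum_smul]
  constructor
  · intro h
    have h0 := h 0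
    rw [if_pos rfl, sub_eq_zero] at h0
    -- As $a_0=1$, the equation for $\beta_0$ can be solved for $t$ without division.
    refine ⟨c (Sum.inl 0), c (Sum.inr 0) + (ω 0 : ℤ) • c (Sum.inl 0), ?_, fun i => ?_⟩
    · rw [Fin.forall_fin_two]
      exact ⟨rfl, h0⟩
    · by_cases hi : i = 0
      · simp [hi, ha0]
      · have := h i
        rw [if_neg hi] at this
        rw [← sub_eq_zero, ← this, smul_add, smul_smul, sub_smul, mul_comm]
        abel
  · rintro ⟨s, t, h1, h2⟩ j
    split_ifs with hj
    · simp [h1]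
    · rw [h1, h2, h2, ha0, sub_smul, smul_sub, smul_smul, smul_smul, Nat.cast_one, mul_one,
        mul_comm (ω 0 : ℤ)]
      abel

theorem mem_bundleFan_cones {σ : Finset (BundleVar m)} : σ ∈ (bundleFan ω a).cones ↔
    (∃ s, Sum.inl s ∉ σ) ∧ ∃ i, Sum.inr i ∉ σ := by
  simp [bundleFan]

/-- The difference $c-e$ has entries $s$ on the $\alpha$'s and $a_it-\omega_is$ on the $\beta$'s. An
$\alpha$ missing from $\sigma$ gives $s\le0$, one missing from $\tau$ gives $s\ge0$. With $s=0$, the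
missing $\beta$'s do the same for $t$, as $a_i>0$. -/
theorem bundleFan_unique (ha0 : a 0 = 1) (ha : ∀ i, 0 < a i) {σ τ : Finset (BundleVar m)}
    (hσ : σ ∈ (bundleFan ω a).cones) (hτ : τ ∈ (bundleFan ω a).cones) {c e : BundleVar m → ℝ}
    (hc : ∀ i, 0 ≤ c i) (he : ∀ i, 0 ≤ e i) (hcσ : ∀ i, i ∉ σ → c i = 0)
    (heτ : ∀ i, i ∉ τ → e i = 0)
    (h : ∀ j, ∑ v, (bundleFan ω a).ray v j • (c - e) v = 0) : c = e := by
  obtain ⟨s, t, h1, h2⟩ := (bundleFan_sum_smul_eq_zero_iff ha0 _).1 h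
  obtain ⟨⟨p, hp⟩, i, hi⟩ := mem_bundleFan_cones.1 hσ
  obtain ⟨⟨p', hp'⟩, i', hi'⟩ := mem_bundleFan_cones.1 hτ
  simp only [Pi.sub_apply, zsmul_eq_mul, Int.cast_natCast] at h1 h2
  have hs : s = 0 := by
    have e1 := h1 p
    have e2 := h1 p'
    rw [hcσ _ hp] at e1
    rw [heτ _ hp'] at e2
    linarith [he (Sum.inl p), hc (Sum.inl p')]
  subst hs
  have ht : t = 0 := by
    have e1 := h2 i
    have e2 := h2 i'
    rw [hcσ _ hi] at e1
    rw [heτ _ hi'] at e2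
    have p1 : (0 : ℝ) < a i := by exact_mod_cast ha i
    have p2 : (0 : ℝ) < a i' := by exact_mod_cast ha i'
    refine le_antisymm ?_ ?_
    · by_contra! h0
      nlinarith [mul_pos p1 h0, he (Sum.inr i)]
    · by_contra! h0
      nlinarith [mul_pos p2 (neg_pos.2 h0), hc (Sum.inr i')]
  subst ht
  funext v
  rcases v with v | v
  · linarith [h1 v]
  · have := h2 v
    simp only [mul_zero, sub_zero] at this
    linarith

theorem bundleFan_span : Submodule.span ℝ (Set.range (bundleFan ω a).realRay) = ⊤ := by
  rw [eq_top_iff, ← (Pi.basisFun ℝ (Fin (m + 1))).span_eq, Submodule.span_le]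
  rintro _ ⟨i, rfl⟩
  apply Submodule.subset_span
  by_cases hi : i = 0
  · refine ⟨Sum.inl 1, ?_⟩
    ext j
    simp [StackyFan.realRay, bundleFan_ray_inl_one, hi, Pi.single_apply]
  · refine ⟨Sum.inr i, ?_⟩
    ext j
    simp [StackyFan.realRay, bundleFan_ray_inr, hi, Pi.single_apply]

/-- For $m=0$ the gcd is taken over the empty set and equals $0$. Well-formedness enters the fan
axioms only through this: a second $\beta$ is needed for $\{\beta_i\}$ to be a cone. -/
theorem WellFormed.pos (hwf : WellFormed a) : m ≠ 0 := by
  rintro rfl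
  have := hwf 0
  simp at this

theorem exists_ne_of_wellFormed (hwf : WellFormed a) (k : Fin (m + 1)) :
    ∃ i, i ≠ k := by
  have : Nontrivial (Fin (m + 1)) := Fin.nontrivial_iff_two_le.2 (by have := hwf.pos; omega)
  exact exists_ne k

theorem bundleFan_isFan (ha0 : a 0 = 1) (ha : ∀ i, 0 < a i) (hwf : WellFormed a) :
    (bundleFan ω a).IsFan := by
  refine StackyFan.isFan_of_unique (fun σ hσ τ hτ => ?_) (fun v => ?_) bundleFan_span
    fun σ hσ τ hτ c e hc he hcσ heτ h => ?_
  · rw [mem_bundleFan_cones] at hσ ⊢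
    exact ⟨hσ.1.imp fun _ h h' => h (hτ h'), hσ.2.imp fun _ h h' => h (hτ h')⟩
  · rw [mem_bundleFan_cones]
    rcases v with v | v
    · obtain ⟨w, hw⟩ := exists_ne v
      exact ⟨⟨w, by simpa using hw⟩, 0, by simp⟩
    · obtain ⟨w, hw⟩ := exists_ne_of_wellFormed hwf v
      exact ⟨⟨0, by simp⟩, w, by simpa using hw⟩
  · refine bundleFan_unique ha0 ha hσ hτ hc he hcσ heτ fun j => ?_
    have := congrFun h j
    rw [StackyFan.sum_smul_realRay_apply, StackyFan.sum_smul_realRay_apply, ← sub_eq_zero,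
      ← Finset.sum_sub_distrib] at this
    rw [← this]
    exact Finset.sum_congr rfl fun v _ => by rw [Pi.sub_apply, smul_sub]

theorem mem_span_range_X_iff {κ ι : Type} (f : κ → ι) {p : MvPolynomial ι ℂ} :
    p ∈ Ideal.span (Set.range fun i => (X (f i) : MvPolynomial ι ℂ)) ↔
      ∀ n ∈ p.support, ∃ i, n (f i) ≠ 0 := by
  rw [← Function.comp_def, Set.range_comp, mem_ideal_span_X_image]
  simp

theorem mem_span_pair_X_iff {ι : Type} (i j : ι) {p : MvPolynomial ι ℂ} :
    p ∈ Ideal.span {X i, X j} ↔ ∀ n ∈ p.support, n i ≠ 0 ∨ n j ≠ 0 := by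
  rw [← Set.image_pair, mem_ideal_span_X_image]
  simp

theorem bundleFan_irrelevantIdeal :
    (bundleFan ω a).irrelevantIdeal = (weightedBundle ω a).irrelevantIdeal := by
  ext p
  simp only [StackyFan.mem_irrelevantIdeal_iff, weightedBundle, Ideal.mem_inf,
    mem_span_pair_X_iff, mem_span_range_X_iff, ← forall₂_and]
  refine forall₂_congr fun n _ => ⟨?_, ?_⟩
  · rintro ⟨σ, hσ, h⟩
    obtain ⟨⟨s, hs⟩, i, hi⟩ := mem_bundleFan_cones.1 hσ
    refine ⟨?_, i, h _ hi⟩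
    have := h _ hs
    fin_cases s
    · exact Or.inl this
    · exact Or.inr this
  · rintro ⟨h1, i, hi⟩
    refine ⟨Finset.univ.filter fun v => n v = 0, mem_bundleFan_cones.2 ⟨?_, i, by simpa using hi⟩,
      fun v => by simp⟩
    rcases h1 with h1 | h1
    · exact ⟨0, by simpa using h1⟩
    · exact ⟨1, by simpa using h1⟩

end BundleFan

/-! ### The star subdivision at $\gamma$ -/

section StarSubdivision

variable {m : ℕ} {ω a b : Fin (m + 1) → ℕ} {k : Fin (m + 1)} {γ : Fin (m + 1) → ℤ}

/-- The existence of the lattice vector at which the fan of the bundle is subdivided. -/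
theorem exists_center (ha0 : a 0 = 1) (hbi : ∀ i, i ≠ k → b i ≡ a i [MOD a k])
    (hbk : ∃ r : ℕ, 0 < r ∧ b k = r * a k) : ∃ γ : Fin (m + 1) → ℤ,
      (a k : ℤ) • γ = ∑ v, (blowUpWeight k b v : ℤ) • (bundleFan ω a).ray v := by
  obtain ⟨r, -, hr⟩ := hbk
  have hdvd : ∀ i, ∃ q : ℤ, i ≠ k → (b i : ℤ) = a i + a k * q := fun i => by
    by_cases hi : i = k
    · exact ⟨0, fun h => absurd hi h⟩
    · obtain ⟨q, hq⟩ := (Nat.modEq_iff_dvd.1 (hbi i hi).symm)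
      exact ⟨q, fun _ => by linarith⟩
  choose q hq using hdvd
  -- Write $b_k=ra_k$ and $b_i=a_i+a_kq_i$. Since $\sum_{i\ne k}a_i\beta_i=-a_k\beta_k$, division by
  -- $a_k$ gives $\gamma=r\alpha_0-\beta_k+\sum_{i\ne k}q_i\beta_i$.
  let g : BundleVar m → ℤ := Sum.elim ![r, 0] fun i => if i = k then -1 else q i
  refine ⟨∑ v, g v • (bundleFan ω a).ray v, ?_⟩
  rw [← sub_eq_zero, Finset.smul_sum, ← Finset.sum_sub_distrib]
  have := (bundleFan_sum_smul_eq_zero_iff (ω := ω) ha0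
    fun v => (a k : ℤ) * g v - blowUpWeight k b v).2 ⟨0, -1, ?_, ?_⟩
  · funext j
    rw [Finset.sum_apply, Pi.zero_apply, ← this j]
    refine Finset.sum_congr rfl fun v _ => ?_
    simp only [Pi.sub_apply, Pi.smul_apply, smul_eq_mul]
    ring
  · rw [Fin.forall_fin_two]
    simp [g, blowUpWeight, hr, mul_comm]
  · intro i
    by_cases hi : i = k
    · simp [g, blowUpWeight, hi]
    · simp [g, blowUpWeight, hi, hq i hi]

theorem blowUpWeight_ne_zero_iff (hb : ∀ i, 0 < b i) {v : BundleVar m} :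
    blowUpWeight k b v ≠ 0 ↔ v ≠ Sum.inl 1 ∧ v ≠ Sum.inr k := by
  rcases v with v | v
  · fin_cases v
    · simp [blowUpWeight, (hb k).ne']
    · simp [blowUpWeight]
  · by_cases hv : v = k
    · simp [blowUpWeight, hv]
    · simp [blowUpWeight, hv, (hb v).ne']

/-- $\gamma$ has positive coefficients on all rays other than $\alpha_1$ and $\beta_k$. By
uniqueness of nonnegative representations, any cone through $\gamma$ must contain all of these rays.
-/
theorem center_mem_cone_iff (ha0 : a 0 = 1) (ha : ∀ i, 0 < a i) (hb : ∀ i, 0 < b i)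
    (hγ : (a k : ℤ) • γ = ∑ v, (blowUpWeight k b v : ℤ) • (bundleFan ω a).ray v)
    {σ : Finset (BundleVar m)} (hσ : σ ∈ (bundleFan ω a).cones) :
    (fun j => (γ j : ℝ)) ∈ (bundleFan ω a).cone σ ↔ ∀ v, v ≠ Sum.inl 1 → v ≠ Sum.inr k → v ∈ σ := by
  have hak : (0 : ℝ) < a k := by exact_mod_cast ha k
  have key : ∀ j, (γ j : ℝ) = ∑ v, (bundleFan ω a).ray v j • ((blowUpWeight k b v : ℝ) / a k) := by
    intro j
    have := congrArg (Int.cast : ℤ → ℝ) (congrFun hγ j)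
    simp only [Pi.smul_apply, Finset.sum_apply, smul_eq_mul, Int.cast_mul, Int.cast_natCast,
      Int.cast_sum] at this
    apply mul_left_cancel₀ hak.ne'
    rw [this, Finset.mul_sum]
    refine Finset.sum_congr rfl fun v _ => ?_
    rw [zsmul_eq_mul]
    field_simp
  constructor
  · rintro ⟨c, hc, hcσ, hx⟩ v hv hv'
    by_contra hvσ
    have hp : (Finset.univ.filter fun v : BundleVar m => v ≠ Sum.inl 1 ∧ v ≠ Sum.inr k) ∈
        (bundleFan ω a).cones := mem_bundleFan_cones.2 ⟨⟨1, by simp⟩, k, by simp⟩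
    have := bundleFan_unique (ω := ω) ha0 ha hσ hp (c := c)
      (e := fun v => (blowUpWeight k b v : ℝ) / a k) hc (fun v => by positivity) hcσ
      (fun v hv => by
        have : blowUpWeight k b v = 0 := by
          by_contra h0
          exact hv (Finset.mem_filter.2 ⟨Finset.mem_univ _, (blowUpWeight_ne_zero_iff hb).1 h0⟩)
        simp [this]) fun j => by
          have h1 := congrFun hx j
          rw [StackyFan.sum_smul_realRay_apply, key, eq_comm, ← sub_eq_zero,
            ← Finset.sum_sub_distrib] at h1
          rw [← h1]
          exact Finset.sum_congr rfl fun v _ => by rw [Pi.sub_apply, smul_sub]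
    have h2 := congrFun this v
    rw [hcσ v hvσ, eq_comm, div_eq_zero_iff] at h2
    have h3 := (blowUpWeight_ne_zero_iff hb (k := k)).2 ⟨hv, hv'⟩
    rcases h2 with h2 | h2
    · exact h3 (by exact_mod_cast h2)
    · exact hak.ne' h2
  · intro h
    refine ⟨fun v => (blowUpWeight k b v : ℝ) / a k, fun v => by positivity, fun v hv => ?_, ?_⟩
    · have : blowUpWeight k b v = 0 := by
        by_contra h0
        obtain ⟨h1, h2⟩ := (blowUpWeight_ne_zero_iff hb).1 h0
        exact hv (h v h1 h2)
      simp [this]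
    · funext j
      rw [StackyFan.sum_smul_realRay_apply]
      exact key j

/-- The five clauses match the five factors of $J$: a cone misses a variable of each. The first two
come from cones of $\Sigma$. The third and fourth hold because a cone through $\gamma$ in $\Sigma$
omits exactly $\alpha_1$ and $\beta_k$ at most one further apiece being impossible, so the faces
joined to the new ray omit them too. The last says that $\gamma$ is not in the old part of the cone.
-/
theorem mem_starSubdivision_cones (ha0 : a 0 = 1) (ha : ∀ i, 0 < a i) (hb : ∀ i, 0 < b i)
    (hγ : (a k : ℤ) • γ = ∑ v, (blowUpWeight k b v : ℤ) • (bundleFan ω a).ray v)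
    {ρ : Finset (BlowUpVar m)} :
    ρ ∈ ((bundleFan ω a).starSubdivision γ).cones ↔
      (some (Sum.inl 0) ∉ ρ ∨ some (Sum.inl 1) ∉ ρ) ∧ (∃ i, some (Sum.inr i) ∉ ρ) ∧
      (none ∉ ρ ∨ some (Sum.inl 1) ∉ ρ) ∧ (none ∉ ρ ∨ some (Sum.inr k) ∉ ρ) ∧
      (some (Sum.inl 0) ∉ ρ ∨ ∃ i, i ≠ k ∧ some (Sum.inr i) ∉ ρ) := by
  have inner : ∀ σ : Finset (BundleVar m), (∀ v, v ≠ Sum.inl 1 → v ≠ Sum.inr k → v ∈ σ) ↔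
      ¬ (Sum.inl 0 ∉ σ ∨ ∃ i, i ≠ k ∧ Sum.inr i ∉ σ) := fun σ => by
    simp [Fin.forall_fin_two]
  constructor
  · rintro (⟨σ, hσ, hγσ, rfl⟩ | ⟨τ, hτ, hγτ, ⟨σ, hσ, hτσ, hγσ⟩, rfl⟩)
    · rw [center_mem_cone_iff ha0 ha hb hγ hσ, inner, not_not] at hγσ
      obtain ⟨⟨s, hs⟩, i, hi⟩ := mem_bundleFan_cones.1 hσ
      refine ⟨?_, ⟨i, by simpa using hi⟩, Or.inl (by simp), Or.inl (by simp), by simpa using hγσ⟩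
      fin_cases s
      · exact Or.inl (by simpa using hs)
      · exact Or.inr (by simpa using hs)
    · rw [center_mem_cone_iff ha0 ha hb hγ hτ, inner, not_not] at hγτ
      rw [center_mem_cone_iff ha0 ha hb hγ hσ] at hγσ
      obtain ⟨⟨s, hs⟩, i, hi⟩ := mem_bundleFan_cones.1 hσ
      -- $\sigma$ contains every ray except possibly $\alpha_1$ and $\beta_k$, so the $\alpha$ and
      -- the $\beta$ it has to omit are these two.
      have h1 : Sum.inl 1 ∉ τ := fun h => by
        fin_cases s
        · exact hs (hγσ _ (by simp) (by simp))
        · exact hs (hτσ h)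
      have h2 : Sum.inr k ∉ τ := fun h => by
        by_cases hik : i = k
        · exact hi (hτσ (hik ▸ h))
        · exact hi (hγσ _ (by simp) (by simpa using hik))
      exact ⟨Or.inr (by simpa using h1), ⟨k, by simpa using h2⟩, Or.inr (by simpa using h1),
        Or.inr (by simpa using h2), by simpa using hγτ⟩
  · rintro ⟨h1, ⟨i, hi⟩, h3, h4, h5⟩
    by_cases hn : none ∈ ρ
    · have h3 := h3.resolve_left (not_not.2 hn)
      have h4 := h4.resolve_left (not_not.2 hn)
      have hτ : Finset.eraseNone ρ ∈ (bundleFan ω a).cones :=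
        mem_bundleFan_cones.2 ⟨⟨1, by simpa using h3⟩, k, by simpa using h4⟩
      have hσ : (Finset.univ.filter fun v : BundleVar m => v ≠ Sum.inl 1 ∧ v ≠ Sum.inr k) ∈
        (bundleFan ω a).cones := mem_bundleFan_cones.2 ⟨⟨1, by simp⟩, k, by simp⟩
      refine Or.inr ⟨Finset.eraseNone ρ, hτ, ?_, ⟨_, hσ, fun v hv => ?_, ?_⟩, ?_⟩
      · rw [center_mem_cone_iff ha0 ha hb hγ hτ, inner, not_not]
        simpa using h5
      · rw [Finset.mem_eraseNone] at hv
        rw [Finset.mem_filter]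
        refine ⟨Finset.mem_univ _, ?_, ?_⟩
        · rintro rfl
          exact h3 hv
        · rintro rfl
          exact h4 hv
      · rw [center_mem_cone_iff ha0 ha hb hγ hσ]
        exact fun v hv hv' => by simp [hv, hv']
      · rw [Finset.insertNone_eraseNone, Finset.insert_eq_of_mem hn]
    · have hσ : Finset.eraseNone ρ ∈ (bundleFan ω a).cones := mem_bundleFan_cones.2
        ⟨h1.elim (fun h => ⟨0, by simpa using h⟩) fun h => ⟨1, by simpa using h⟩, i,
          by simpa using hi⟩
      refine Or.inl ⟨Finset.eraseNone ρ, hσ, ?_, ?_⟩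
      · rw [center_mem_cone_iff ha0 ha hb hγ hσ, inner, not_not]
        simpa using h5
      · rw [Finset.map_some_eraseNone, Finset.erase_eq_of_notMem hn]

theorem starSubdivision_irrelevantIdeal (ha0 : a 0 = 1) (ha : ∀ i, 0 < a i) (hb : ∀ i, 0 < b i)
    (hγ : (a k : ℤ) • γ = ∑ v, (blowUpWeight k b v : ℤ) • (bundleFan ω a).ray v) :
    ((bundleFan ω a).starSubdivision γ).irrelevantIdeal =
      (rankThreeStack ω a k b).irrelevantIdeal := by
  have hset : (insert (X (some (Sum.inl 0))) {p | ∃ i, i ≠ k ∧ p = X (some (Sum.inr i))} :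
      Set (MvPolynomial (BlowUpVar m) ℂ)) =
      X '' (insert (some (Sum.inl 0)) {v | ∃ i, i ≠ k ∧ v = some (Sum.inr i)}) := by
    rw [Set.image_insert_eq]
    congr 1
    ext p
    constructor
    · rintro ⟨i, hi, rfl⟩
      exact ⟨_, ⟨i, hi, rfl⟩, rfl⟩
    · rintro ⟨_, ⟨i, hi, rfl⟩, rfl⟩
      exact ⟨i, hi, rfl⟩
  ext p
  simp only [StackyFan.mem_irrelevantIdeal_iff, mem_starSubdivision_cones ha0 ha hb hγ,
    rankThreeStack, hset, Ideal.mem_inf, mem_span_pair_X_iff, mem_span_range_X_iff,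
    mem_ideal_span_X_image, ← forall₂_and]
  refine forall₂_congr fun n _ => ⟨?_, ?_⟩
  · rintro ⟨σ, ⟨h1, ⟨i, hi⟩, h3, h4, h5⟩, h⟩
    refine ⟨⟨⟨⟨h1.imp (h _) (h _), i, h _ hi⟩, h3.imp (h _) (h _)⟩, h4.imp (h _) (h _)⟩, ?_⟩
    rcases h5 with h5 | ⟨i, hik, h5⟩
    · exact ⟨_, Or.inl rfl, h _ h5⟩
    · exact ⟨_, Or.inr ⟨i, hik, rfl⟩, h _ h5⟩
  · rintro ⟨⟨⟨⟨h1, h2⟩, h3⟩, h4⟩, v, hv, h5⟩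
    refine ⟨Finset.univ.filter fun v => n v = 0, ⟨by simpa using h1, by simpa using h2,
      by simpa using h3, by simpa using h4, ?_⟩, fun v => by simp⟩
    rcases hv with rfl | ⟨i, hik, rfl⟩
    · exact Or.inl (by simpa using h5)
    · exact Or.inr ⟨i, hik, by simpa using h5⟩

/-- Eliminating $\gamma$ gives a relation of $\Sigma$ with coefficients $a_k(c-e)_v+b_v(c-e)_\xi$,
hence parameters $s,t$. If $c_\xi<e_\xi$, then $\xi\in\tau$, so $e$ vanishes at $X_1$ and $Y_k$;
this yields $s\ge0$, then $X_0\in\sigma$, $s=0$, $t\ge0$, and some $Y_i\notin\sigma$ with $i\ne k$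
contradicts the sign of $t$. With equal $\xi$-coefficients, uniqueness in $\Sigma$ applies. The
assumption $c_\xi\le e_\xi$ costs nothing by symmetry. -/
theorem starSubdivision_unique (ha0 : a 0 = 1) (ha : ∀ i, 0 < a i) (hb : ∀ i, 0 < b i)
    (hγ : (a k : ℤ) • γ = ∑ v, (blowUpWeight k b v : ℤ) • (bundleFan ω a).ray v)
    {σ τ : Finset (BlowUpVar m)} (hσ : σ ∈ ((bundleFan ω a).starSubdivision γ).cones)
    (hτ : τ ∈ ((bundleFan ω a).starSubdivision γ).cones) {c e : BlowUpVar m → ℝ}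
    (hc : ∀ i, 0 ≤ c i) (he : ∀ i, 0 ≤ e i) (hcσ : ∀ i, i ∉ σ → c i = 0)
    (heτ : ∀ i, i ∉ τ → e i = 0)
    (h : ∀ j, ∑ v, ((bundleFan ω a).starSubdivision γ).ray v j • (c - e) v = 0)
    (hle : c none ≤ e none) : c = e := by
  have hrel : ∀ j, ∑ v, (bundleFan ω a).ray v j •
      ((a k : ℝ) * (c - e) (some v) + blowUpWeight k b v * (c - e) none) = 0 := by
    intro j
    have h1 := h j
    rw [Fintype.sum_option] at h1
    have h2 := congrArg (Int.cast : ℤ → ℝ) (congrFun hγ j)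
    simp only [Pi.smul_apply, Finset.sum_apply, smul_eq_mul, Int.cast_mul, Int.cast_natCast,
      Int.cast_sum] at h2
    simp only [StackyFan.starSubdivision, Option.elim, zsmul_eq_mul] at h1 ⊢
    calc _ = (a k : ℝ) * ∑ v, ((bundleFan ω a).ray v j : ℝ) * (c - e) (some v) +
          (∑ v, (blowUpWeight k b v : ℝ) * ((bundleFan ω a).ray v j : ℝ)) * (c - e) none := by
          rw [Finset.mul_sum, Finset.sum_mul, ← Finset.sum_add_distrib]
          exact Finset.sum_congr rfl fun v _ => by ring
      _ = (a k : ℝ) * (γ j * (c - e) none +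
          ∑ v, ((bundleFan ω a).ray v j : ℝ) * (c - e) (some v)) := by rw [← h2]; ring
      _ = 0 := by rw [h1, mul_zero]
  have hak : (0 : ℝ) < a k := by exact_mod_cast ha k
  rw [mem_starSubdivision_cones ha0 ha hb hγ] at hσ hτ
  obtain ⟨s, t, h1, h2⟩ := (bundleFan_sum_smul_eq_zero_iff ha0 _).1 hrel
  have hX0 := h1 0
  have hX1 := h1 1
  simp only [Pi.sub_apply, zsmul_eq_mul, Int.cast_natCast, blowUpWeight, Sum.elim_inl,
    Matrix.cons_val_zero, Matrix.cons_val_one, Nat.cast_zero, zero_mul, add_zero] at h2 hX0 hX1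
  have hbk : (0 : ℝ) < b k := by exact_mod_cast hb k
  have hnone : c none = e none := by
    by_contra hne
    have hlt : c none < e none := lt_of_le_of_ne hle hne
    have hτn : none ∈ τ := by
      by_contra h0
      rw [heτ _ h0] at hlt
      exact absurd (hc none) (not_le.2 hlt)
    rw [heτ _ (hτ.2.2.1.resolve_left (not_not.2 hτn)), sub_zero] at hX1
    have hYk := h2 k
    rw [Sum.elim_inr, if_pos rfl, heτ _ (hτ.2.2.2.1.resolve_left (not_not.2 hτn))] at hYk
    simp only [sub_zero, Nat.cast_zero, zero_mul, add_zero] at hYk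
    have hs : 0 ≤ s := hX1 ▸ mul_nonneg hak.le (hc _)
    -- Otherwise $a_k(c-e)_{X_0}+b_k(c-e)_\xi$ would be negative, but it equals $s\ge0$.
    have p1 : 0 < c (some (Sum.inl 0)) := by
      by_contra! h0
      nlinarith [mul_pos hbk (sub_pos.2 hlt), mul_nonneg hak.le (he (some (Sum.inl 0))),
        mul_nonneg hak.le (neg_nonneg.2 h0)]
    have q1 : some (Sum.inl 0) ∈ σ := by
      by_contra h0
      exact p1.ne' (hcσ _ h0)
    rw [hcσ _ (hσ.1.resolve_left (not_not.2 q1)), mul_zero] at hX1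
    subst hX1
    have ht : 0 ≤ t := by
      have : 0 ≤ (a k : ℝ) * t := by linarith [mul_nonneg hak.le (hc (some (Sum.inr k)))]
      exact nonneg_of_mul_nonneg_right this hak
    obtain ⟨i, hik, hi⟩ := hσ.2.2.2.2.resolve_left (not_not.2 q1)
    have hYi := h2 i
    rw [Sum.elim_inr, if_neg hik, hcσ _ hi] at hYi
    have hbi : (0 : ℝ) < b i := by exact_mod_cast hb i
    have hai : (0 : ℝ) < a i := by exact_mod_cast ha i
    -- The relation reads $-a_ke_{Y_i}+b_i(c-e)_\xi=a_it$: the left side is negative, the right side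
    -- is not.
    nlinarith [mul_pos hbi (sub_pos.2 hlt), mul_nonneg hak.le (he (some (Sum.inr i))),
      mul_nonneg hai.le ht]
  have hold : ∀ ρ : Finset (BlowUpVar m), (some (Sum.inl 0) ∉ ρ ∨ some (Sum.inl 1) ∉ ρ) →
      (∃ i, some (Sum.inr i) ∉ ρ) → Finset.eraseNone ρ ∈ (bundleFan ω a).cones :=
    fun ρ h1 h2 => mem_bundleFan_cones.2
      ⟨h1.elim (fun h => ⟨0, by simpa using h⟩) fun h => ⟨1, by simpa using h⟩, by simpa using h2⟩
  have := bundleFan_unique (ω := ω) ha0 ha (hold σ hσ.1 hσ.2.1) (hold τ hτ.1 hτ.2.1)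
    (c := fun v => c (some v)) (e := fun v => e (some v)) (fun _ => hc _) (fun _ => he _)
    (fun v hv => hcσ _ (by simpa using hv)) (fun v hv => heτ _ (by simpa using hv)) fun j => by
      have h3 := hrel j
      simp only [Pi.sub_apply, hnone, sub_self, mul_zero, add_zero, ← mul_smul_comm,
        ← Finset.mul_sum] at h3
      exact (mul_eq_zero.1 h3).resolve_left hak.ne'
  funext v
  cases v with
  | none => exact hnone
  | some v => exact congrFun this v

theorem starSubdivision_isFan (ha0 : a 0 = 1) (ha : ∀ i, 0 < a i) (hwf : WellFormed a)
    (hb : ∀ i, 0 < b i)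
    (hγ : (a k : ℤ) • γ = ∑ v, (blowUpWeight k b v : ℤ) • (bundleFan ω a).ray v) :
    ((bundleFan ω a).starSubdivision γ).IsFan := by
  refine StackyFan.isFan_of_unique (fun σ hσ τ hτ => ?_) (fun v => ?_) ?_
    fun σ hσ τ hτ c e hc he hcσ heτ h => ?_
  · rw [mem_starSubdivision_cones ha0 ha hb hγ] at hσ ⊢
    have hm : ∀ {v}, v ∉ σ → v ∉ τ := fun h h' => h (hτ h')
    exact ⟨hσ.1.imp hm hm, hσ.2.1.imp fun _ => hm, hσ.2.2.1.imp hm hm, hσ.2.2.2.1.imp hm hm,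
      hσ.2.2.2.2.imp hm fun ⟨i, hi, h⟩ => ⟨i, hi, hm h⟩⟩
  · rw [mem_starSubdivision_cones ha0 ha hb hγ]
    obtain ⟨i, hi⟩ := exists_ne_of_wellFormed hwf k
    rcases v with _ | v | v
    · simp
    · simp only [Finset.mem_singleton, Option.some.injEq, Sum.inl.injEq, reduceCtorEq,
        not_false_eq_true, exists_const, true_or, true_and, and_true]
      exact ⟨by fin_cases v <;> simp, Or.inr ⟨i, hi⟩⟩
    · obtain ⟨j, hj⟩ := exists_ne_of_wellFormed hwf v
      simp only [Finset.mem_singleton, Option.some.injEq, Sum.inr.injEq, reduceCtorEq,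
        not_false_eq_true, true_or, true_and, and_true]
      exact ⟨j, hj⟩
  · rw [eq_top_iff, ← bundleFan_span (ω := ω) (a := a)]
    refine Submodule.span_mono ?_
    rintro _ ⟨v, rfl⟩
    exact ⟨some v, rfl⟩
  · have h' : ∀ j, ∑ v, ((bundleFan ω a).starSubdivision γ).ray v j • (c - e) v = 0 := fun j => by
      have := congrFun h j
      rw [StackyFan.sum_smul_realRay_apply, StackyFan.sum_smul_realRay_apply, ← sub_eq_zero,
        ← Finset.sum_sub_distrib] at this
      rw [← this]
      exact Finset.sum_congr rfl fun v _ => by rw [Pi.sub_apply, smul_sub]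
    rcases le_total (c none) (e none) with hle | hle
    · exact starSubdivision_unique ha0 ha hb hγ hσ hτ hc he hcσ heτ h' hle
    · refine (starSubdivision_unique ha0 ha hb hγ hτ hσ he hc heτ hcσ (fun j => ?_) hle).symm
      rw [← neg_eq_zero, ← h' j, ← Finset.sum_neg_distrib]
      exact Finset.sum_congr rfl fun v _ => by rw [← smul_neg, ← Pi.neg_apply, neg_sub]

end StarSubdivision

/-! ### Torus actions, Cox groups and the generic stabiliser -/

section Groups

variable {m : ℕ} {ω a b : Fin (m + 1) → ℕ} {k : Fin (m + 1)} {γ : Fin (m + 1) → ℤ}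

theorem weightHom_weightedBundle_inl (x : Fin 2 → ℂˣ) (i : Fin 2) :
    weightHom (weightedBundle ω a).weights x (Sum.inl i) = x 0 := by
  simp [weightHom, weightedBundle, Fin.prod_univ_two]

theorem weightHom_weightedBundle_inr (x : Fin 2 → ℂˣ) (i : Fin (m + 1)) :
    weightHom (weightedBundle ω a).weights x (Sum.inr i) = x 0 ^ (-(ω i : ℤ)) * x 1 ^ a i := by
  simp [weightHom, weightedBundle, Fin.prod_univ_two]

theorem weightHom_rankThreeStack_some (x : Fin 3 → ℂˣ) (v : BundleVar m) :
    weightHom (rankThreeStack ω a k b).weights x (some v) =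
      weightHom (weightedBundle ω a).weights ![x 0, x 1] v * x 2 ^ blowUpWeight k b v := by
  simp [weightHom, rankThreeStack, Fin.prod_univ_two, Fin.prod_univ_three]

theorem weightHom_rankThreeStack_none (x : Fin 3 → ℂˣ) :
    weightHom (rankThreeStack ω a k b).weights x none = (x 2 ^ a k)⁻¹ := by
  simp [weightHom, rankThreeStack, Fin.prod_univ_three]

theorem mem_weightedBundle_group {g : BundleVar m → ℂˣ} : g ∈ (weightedBundle ω a).group ↔
    ∃ s t : ℂˣ, (∀ i, g (Sum.inl i) = s) ∧ ∀ i, g (Sum.inr i) = s ^ (-(ω i : ℤ)) * t ^ a i := by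
  constructor
  · rintro ⟨x, rfl⟩
    exact ⟨x 0, x 1, weightHom_weightedBundle_inl x, weightHom_weightedBundle_inr x⟩
  · rintro ⟨s, t, h1, h2⟩
    refine ⟨![s, t], ?_⟩
    funext v
    rcases v with v | v
    · rw [weightHom_weightedBundle_inl, h1]
      rfl
    · rw [weightHom_weightedBundle_inr, h2]
      rfl

theorem mem_rankThreeStack_group {g : BlowUpVar m → ℂˣ} :
    g ∈ (rankThreeStack ω a k b).group ↔ ∃ h ∈ (weightedBundle ω a).group, ∃ u : ℂˣ,
      (∀ v, g (some v) = h v * u ^ blowUpWeight k b v) ∧ g none = (u ^ a k)⁻¹ := by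
  constructor
  · rintro ⟨x, rfl⟩
    exact ⟨_, ⟨![x 0, x 1], rfl⟩, x 2, weightHom_rankThreeStack_some x,
      weightHom_rankThreeStack_none x⟩
  · rintro ⟨_, ⟨x, rfl⟩, u, h1, h2⟩
    refine ⟨![x 0, x 1, u], ?_⟩
    have hx : ![x 0, x 1] = x := by
      funext i
      fin_cases i <;> rfl
    funext v
    cases v with
    | none => rw [weightHom_rankThreeStack_none, h2]; rfl
    | some v =>
      rw [weightHom_rankThreeStack_some, h1, ← hx]
      rfl

theorem weightHom_weightedBundle_injective (ha0 : a 0 = 1) :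
    Function.Injective (weightHom (weightedBundle ω a).weights) := by
  rw [injective_iff_map_eq_one]
  intro x hx
  have h0 : x 0 = 1 := by
    rw [← weightHom_weightedBundle_inl (ω := ω) (a := a) x 0, hx, Pi.one_apply]
  have h1 := weightHom_weightedBundle_inr (ω := ω) (a := a) x 0
  rw [hx, h0, ha0, one_zpow, one_mul, pow_one, Pi.one_apply] at h1
  funext i
  fin_cases i
  · exact h0
  · exact h1.symm

theorem mem_coxGroup_iff {d : ℕ} {ι : Type} [Fintype ι] {S : StackyFan d ι} {t : ι → ℂˣ} :
    t ∈ S.coxGroup ↔ ∀ j, ∑ i, S.ray i j • Additive.ofMul (t i) = 0 := by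
  change (∀ j, ∏ i, t i ^ S.ray i j = 1) ↔ _
  refine forall_congr' fun j => ?_
  rw [← ofMul_eq_zero, ofMul_prod]
  rfl

/-- The equations of the Cox group are relations among the rays with coefficients in $\mathbb C^*$;
their parameters $s,t$ are the coordinates of $(\mathbb C^*)^2$. -/
theorem bundleFan_coxGroup (ha0 : a 0 = 1) :
    (bundleFan ω a).coxGroup = (weightedBundle ω a).group := by
  ext g
  rw [mem_coxGroup_iff, bundleFan_sum_smul_eq_zero_iff ha0, mem_weightedBundle_group]
  refine exists_congr fun s => exists_congr fun t => and_congr Iff.rfl (forall_congr' fun i => ?_)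
  have : (s.toMul ^ (-(ω i : ℤ)) * t.toMul ^ a i) =
      ((a i : ℤ) • t - (ω i : ℤ) • s).toMul := by
    rw [toMul_sub, toMul_zsmul, toMul_zsmul, zpow_neg, zpow_natCast, zpow_natCast, div_eq_mul_inv,
      mul_comm]
  exact Iff.trans Iff.rfl (Eq.congr_right this.symm)

theorem exists_unit_pow_eq {r : ℕ} (hr : 0 < r) (x : ℂˣ) : ∃ y : ℂˣ, y ^ r = x := by
  obtain ⟨y, hy⟩ := IsAlgClosed.exists_pow_nat_eq (x : ℂ) hr
  have hy0 : y ≠ 0 := by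
    rintro rfl
    rw [zero_pow hr.ne'] at hy
    exact x.ne_zero hy.symm
  exact ⟨Units.mk0 y hy0, Units.ext (by simpa using hy)⟩

theorem smul_neg_add_sum_smul_add {M κ : Type*} [AddCommGroup M] [Fintype κ] {p q : ℤ}
    (r w : κ → ℤ) (c : κ → M) (u : M) (h : p * q = ∑ i, r i * w i) :
    q • -(p • u) + ∑ i, r i • (c i + w i • u) = ∑ i, r i • c i := by
  simp only [smul_add, smul_neg, smul_smul, Finset.sum_add_distrib, ← Finset.sum_smul, ← h,
    mul_comm p]
  rw [neg_add_eq_sub, add_sub_cancel_right]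

/-- Write $g=(h_vu^{b_v},u^{-a_k})$. The powers of $u$ cancel in each equation because
$a_k\gamma=\sum_vb_vu_v$, so $g$ satisfies the equations of the subdivision exactly when $h$
satisfies those of $\Sigma$. -/
theorem starSubdivision_coxGroup (ha0 : a 0 = 1) (ha : ∀ i, 0 < a i)
    (hγ : (a k : ℤ) • γ = ∑ v, (blowUpWeight k b v : ℤ) • (bundleFan ω a).ray v) :
    ((bundleFan ω a).starSubdivision γ).coxGroup = (rankThreeStack ω a k b).group := by
  have key : ∀ (g : BlowUpVar m → ℂˣ) (h : BundleVar m → ℂˣ) (u : ℂˣ),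
      (∀ v, g (some v) = h v * u ^ blowUpWeight k b v) → g none = (u ^ a k)⁻¹ →
      (g ∈ ((bundleFan ω a).starSubdivision γ).coxGroup ↔ h ∈ (weightedBundle ω a).group) := by
    intro g h u h1 h2
    rw [← bundleFan_coxGroup ha0, mem_coxGroup_iff, mem_coxGroup_iff]
    refine forall_congr' fun j => ?_
    rw [Fintype.sum_option]
    have hγj : (a k : ℤ) * γ j = ∑ v, (bundleFan ω a).ray v j * blowUpWeight k b v := by
      simpa [mul_comm] using congrFun hγ j
    have e1 : ∀ v, Additive.ofMul (g (some v)) = Additive.ofMul (h v) +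
        (blowUpWeight k b v : ℤ) • Additive.ofMul u := fun v => by
      rw [h1, ofMul_mul, ofMul_pow, natCast_zsmul]
    have e2 : Additive.ofMul (g none) = -((a k : ℤ) • Additive.ofMul u) := by
      rw [h2, ofMul_inv, ofMul_pow, natCast_zsmul]
    simp only [StackyFan.starSubdivision, Option.elim, e1, e2]
    exact Eq.congr_left (smul_neg_add_sum_smul_add _ _ _ _ hγj)
  ext g
  constructor
  · intro hg
    -- Every $g$ has the required form, since $a_k$-th roots exist in $\mathbb C^*$.
    obtain ⟨u, hu⟩ := exists_unit_pow_eq (ha k) (g none)⁻¹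
    have h1 : ∀ v, g (some v) =
        (g (some v) * (u ^ blowUpWeight k b v)⁻¹) * u ^ blowUpWeight k b v := fun v => by group
    have h2 : g none = (u ^ a k)⁻¹ := by rw [hu, inv_inv]
    exact mem_rankThreeStack_group.2 ⟨_, (key g _ u h1 h2).1 hg, u, h1, h2⟩
  · intro hg
    obtain ⟨h, hh, u, h1, h2⟩ := mem_rankThreeStack_group.1 hg
    exact (key g h u h1 h2).2 hh

/-- Roots of unity act through the torus of the bundle. -/
theorem pow_blowUpWeight_mem_group (hbi : ∀ i, i ≠ k → b i ≡ a i [MOD a k])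
    (hbk : ∃ r : ℕ, 0 < r ∧ b k = r * a k) {ε : ℂˣ} (hε : ε ^ a k = 1) :
    (fun v => ε ^ blowUpWeight k b v) ∈ (weightedBundle ω a).group := by
  obtain ⟨r, -, hr⟩ := hbk
  -- The torus element is $(1,\varepsilon)$: $\varepsilon^{b_i}=\varepsilon^{a_i}$ for $i\neq k$,
  -- and $a_k\mid b_k$ makes the $x_0$-entry trivial.
  refine mem_weightedBundle_group.2 ⟨1, ε, ?_, fun i => ?_⟩
  · rw [Fin.forall_fin_two]
    simp [blowUpWeight, hr, mul_comm r, pow_mul, hε]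
  · rw [one_zpow, one_mul]
    by_cases hi : i = k
    · simp [blowUpWeight, hi, hε]
    · simp only [blowUpWeight, Sum.elim_inr, if_neg hi]
      exact pow_eq_pow_of_modEq (hbi i hi) hε

/-- The coordinate $\xi$ gives $x_2^{a_k}=1$, $X_1$ gives the first entry $1$, and $Y_0$, where
$a_0=1$, gives $x_1x_2=1$. For $k=0$ the first condition already says $x_2=1$. The converse is the
congruences. -/
theorem mem_ker_weightHom_rankThreeStack (ha0 : a 0 = 1)
    (hbi : ∀ i, i ≠ k → b i ≡ a i [MOD a k]) (hbk : ∃ r : ℕ, 0 < r ∧ b k = r * a k)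
    {x : Fin 3 → ℂˣ} : x ∈ (weightHom (rankThreeStack ω a k b).weights).ker ↔
      x = ![1, (x 2)⁻¹, x 2] ∧ x 2 ^ a k = 1 := by
  rw [MonoidHom.mem_ker]
  constructor
  · intro hx
    have hsome : ∀ v, weightHom (weightedBundle ω a).weights ![x 0, x 1] v *
        x 2 ^ blowUpWeight k b v = 1 := fun v => by
      rw [← weightHom_rankThreeStack_some, hx, Pi.one_apply]
    have hn : x 2 ^ a k = 1 := by
      have := weightHom_rankThreeStack_none (ω := ω) (b := b) (a := a) (k := k) x
      rwa [hx, Pi.one_apply, eq_comm, inv_eq_one] at this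
    have h0 : x 0 = 1 := by
      have := hsome (Sum.inl 1)
      rw [weightHom_weightedBundle_inl] at this
      simpa [blowUpWeight] using this
    have h1 : x 1 * x 2 = 1 := by
      by_cases hk : k = 0
      · subst hk
        have := hsome (Sum.inr 0)
        rw [weightHom_weightedBundle_inr] at this
        rw [ha0, pow_one] at hn
        rw [hn]
        simpa [blowUpWeight, h0, ha0] using this
      · have := hsome (Sum.inr 0)
        rw [weightHom_weightedBundle_inr] at this
        have hb0 : x 2 ^ blowUpWeight k b (Sum.inr 0) = x 2 := by
          simp only [blowUpWeight, Sum.elim_inr, if_neg (Ne.symm hk)]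
          rw [pow_eq_pow_of_modEq (hbi 0 (Ne.symm hk)) hn, ha0, pow_one]
        rw [hb0] at this
        simpa [h0, ha0] using this
    refine ⟨?_, hn⟩
    funext i
    fin_cases i
    · exact h0
    · exact eq_inv_of_mul_eq_one_left h1
    · rfl
  · rintro ⟨hx, hn⟩
    have h0 : x 0 = 1 := by rw [hx]; rfl
    have h1 : x 1 = (x 2)⁻¹ := by rw [hx]; rfl
    have hpow : ∀ i, i ≠ k → x 2 ^ b i = x 2 ^ a i := fun i hi =>
      pow_eq_pow_of_modEq (hbi i hi) hn
    obtain ⟨r, -, hr⟩ := hbk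
    funext v
    rcases v with _ | v | v
    · rw [weightHom_rankThreeStack_none, hn, inv_one, Pi.one_apply]
    · rw [weightHom_rankThreeStack_some, weightHom_weightedBundle_inl]
      fin_cases v <;> simp [h0, blowUpWeight, hr, mul_comm r, pow_mul, hn]
    · rw [weightHom_rankThreeStack_some, weightHom_weightedBundle_inr]
      by_cases hv : v = k
      · simp [h0, h1, blowUpWeight, hv, hn]
      · simp [h0, h1, blowUpWeight, hv, hpow v hv]

/-- The projection of the generic stabiliser to the last coordinate of the torus. -/
noncomputable def kerEquivRootsOfUnity (ha0 : a 0 = 1)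
    (hbi : ∀ i, i ≠ k → b i ≡ a i [MOD a k]) (hbk : ∃ r : ℕ, 0 < r ∧ b k = r * a k) :
    (weightHom (rankThreeStack ω a k b).weights).ker ≃* rootsOfUnity (a k) ℂ where
  toFun x := ⟨x.1 2, (mem_ker_weightHom_rankThreeStack ha0 hbi hbk).1 x.2 |>.2⟩
  invFun u := ⟨![1, u.1⁻¹, u.1],
    (mem_ker_weightHom_rankThreeStack ha0 hbi hbk).2 ⟨rfl, u.2⟩⟩
  left_inv x := Subtype.ext ((mem_ker_weightHom_rankThreeStack ha0 hbi hbk).1 x.2).1.symm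
  right_inv _ := rfl
  map_mul' _ _ := rfl

/-- The columns of $X_1,Y_k,\xi$ form a triangular minor with determinant $-a_k^2$. -/
theorem rankThreeStack_weights_rank (ha : ∀ i, 0 < a i) :
    ((rankThreeStack ω a k b).weights.map (Int.cast : ℤ → ℚ)).rank = 3 := by
  have hak : (a k : ℚ) ≠ 0 := by exact_mod_cast (ha k).ne'
  refine (LinearIndependent.rank_matrix ?_).trans (Fintype.card_fin 3)
  rw [Fintype.linearIndependent_iff]
  intro g hg
  have hX := congrFun hg (some (Sum.inl 1))
  have hY := congrFun hg (some (Sum.inr k))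
  have hn := congrFun hg none
  simp only [Finset.sum_apply, Pi.smul_apply, Matrix.row, Matrix.map_apply, Fin.sum_univ_three]
    at hX hY hn
  simp [rankThreeStack, weightedBundle, blowUpWeight] at hX hY hn
  have h2 : g 2 = 0 := hn.resolve_right (ha k).ne'
  have h1 : g 1 = 0 := by simpa [hX, (ha k).ne'] using hY
  intro i
  fin_cases i
  · exact hX
  · exact h1
  · exact h2

end Groups

/-! ### Stable loci and maps between quotients -/

section StableLocus

theorem mem_stableLocus_inf {ι : Type} {I J : Ideal (MvPolynomial ι ℂ)} {z : ι → ℂ} :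
    z ∈ stableLocus (I ⊓ J) ↔ z ∈ stableLocus I ∧ z ∈ stableLocus J := by
  simp only [stableLocus, Set.mem_compl_iff, mem_zeroLocus_iff]
  constructor
  · exact fun h => ⟨fun h' => h fun p hp => h' p hp.1, fun h' => h fun p hp => h' p hp.2⟩
  · rintro ⟨h1, h2⟩ h
    push Not at h1 h2
    obtain ⟨p, hp, hp0⟩ := h1
    obtain ⟨q, hq, hq0⟩ := h2
    have := h (p * q) ⟨I.mul_mem_right _ hp, J.mul_mem_left _ hq⟩
    rw [map_mul] at this
    exact mul_ne_zero hp0 hq0 this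

theorem mem_stableLocus_span {ι : Type} {s : Set (MvPolynomial ι ℂ)} {z : ι → ℂ} :
    z ∈ stableLocus (Ideal.span s) ↔ ∃ p ∈ s, eval z p ≠ 0 := by
  rw [stableLocus, zeroLocus_span]
  simp

variable {m : ℕ} {ω a b : Fin (m + 1) → ℕ} {k : Fin (m + 1)}

theorem mem_stableLocus_weightedBundle {z : BundleVar m → ℂ} :
    z ∈ stableLocus (weightedBundle ω a).irrelevantIdeal ↔
      (z (Sum.inl 0) ≠ 0 ∨ z (Sum.inl 1) ≠ 0) ∧ ∃ i, z (Sum.inr i) ≠ 0 := by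
  simp [weightedBundle, mem_stableLocus_inf, mem_stableLocus_span]

/-- The last factor of $J$ is generated by the variables that are local coordinates at $p$. -/
theorem exists_chartVar {p : BundleVar m → Prop} :
    (p (Sum.inl 0) ∨ ∃ i, i ≠ k ∧ p (Sum.inr i)) ↔ ∃ v : ChartVar k, p v.1 := by
  simp [Fin.exists_fin_two]

theorem mem_stableLocus_rankThreeStack {z : BlowUpVar m → ℂ} :
    z ∈ stableLocus (rankThreeStack ω a k b).irrelevantIdeal ↔
      ((z (some (Sum.inl 0)) ≠ 0 ∨ z (some (Sum.inl 1)) ≠ 0) ∧ ∃ i, z (some (Sum.inr i)) ≠ 0) ∧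
      (z none ≠ 0 ∨ z (some (Sum.inl 1)) ≠ 0) ∧ (z none ≠ 0 ∨ z (some (Sum.inr k)) ≠ 0) ∧
      ∃ v : ChartVar k, z (some v.1) ≠ 0 := by
  rw [← exists_chartVar (k := k) (p := fun v => z (some v) ≠ 0)]
  simp only [rankThreeStack, mem_stableLocus_inf, mem_stableLocus_span, and_assoc]
  simp only [Set.exists_range_iff, Set.exists_mem_insert, Set.mem_singleton_iff,
    exists_eq_left, eval_X]
  refine and_congr_right fun _ => and_congr_right fun _ => and_congr_right fun _ =>
    and_congr_right fun _ => or_congr_right ?_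
  constructor
  · rintro ⟨_, ⟨i, hi, rfl⟩, h⟩
    exact ⟨i, hi, by simpa using h⟩
  · rintro ⟨i, hi, h⟩
    exact ⟨_, ⟨i, hi, rfl⟩, by simpa using h⟩

theorem mem_stableLocus_weightedBlowUp {δ : Type} {z : Option δ → ℂ} :
    z ∈ stableLocus
      (Ideal.span (Set.range fun i : δ => (X (some i) : MvPolynomial (Option δ) ℂ))) ↔
      ∃ i, z (some i) ≠ 0 := by
  simp [mem_stableLocus_span]

theorem mem_stableLocus_top {ι : Type} (z : ι → ℂ) :
    z ∈ stableLocus (⊤ : Ideal (MvPolynomial ι ℂ)) := by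
  simp [stableLocus, zeroLocus_top]

theorem smul_mem_weightedBundle {z : BundleVar m → ℂ}
    (hz : z ∈ stableLocus (weightedBundle ω a).irrelevantIdeal) (t : BundleVar m → ℂˣ) :
    (fun i => (t i : ℂ) * z i) ∈ stableLocus (weightedBundle ω a).irrelevantIdeal := by
  rw [mem_stableLocus_weightedBundle] at hz ⊢
  simpa using hz

theorem smul_mem_rankThreeStack {z : BlowUpVar m → ℂ}
    (hz : z ∈ stableLocus (rankThreeStack ω a k b).irrelevantIdeal) (t : BlowUpVar m → ℂˣ) :
    (fun i => (t i : ℂ) * z i) ∈ stableLocus (rankThreeStack ω a k b).irrelevantIdeal := by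
  rw [mem_stableLocus_rankThreeStack] at hz ⊢
  simpa using hz

theorem smul_mem_weightedBlowUp {δ : Type} {z : Option δ → ℂ}
    (hz : z ∈ stableLocus
      (Ideal.span (Set.range fun i : δ => (X (some i) : MvPolynomial (Option δ) ℂ))))
    (t : Option δ → ℂˣ) : (fun i => (t i : ℂ) * z i) ∈ stableLocus
      (Ideal.span (Set.range fun i : δ => (X (some i) : MvPolynomial (Option δ) ℂ))) := by
  rw [mem_stableLocus_weightedBlowUp] at hz ⊢
  simpa using hz

/-- A relation between homogeneous coordinates that is compatible with the group actions defines
a map of quotients. -/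
theorem exists_quotient_map {ι ι' : Type} {I : Ideal (MvPolynomial ι ℂ)}
    {G : Subgroup (ι → ℂˣ)} {I' : Ideal (MvPolynomial ι' ℂ)} {G' : Subgroup (ι' → ℂˣ)}
    (R : (ι → ℂ) → (ι' → ℂ) → Prop)
    (total : ∀ z ∈ stableLocus I, ∃ z' ∈ stableLocus I', R z z')
    (compat : ∀ z ∈ stableLocus I, ∀ t ∈ G, ∀ w, (∀ i, w i = (t i : ℂ) * z i) → ∀ z' w', R z z' →
      R w w' → ∃ t' ∈ G', ∀ i, w' i = (t' i : ℂ) * z' i) :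
    ∃ f : quotientSpace I G → quotientSpace I' G', ∀ z hz z' hz', R z z' →
      f (quotientSpace.mk z hz) = quotientSpace.mk z' hz' := by
  have : ∀ x : quotientSpace I G, ∃ y : quotientSpace I' G', ∀ z hz z' hz', R z z' →
      x = quotientSpace.mk z hz → y = quotientSpace.mk z' hz' := by
    intro x
    induction x using quotientSpace.ind with
    | h w hw =>
      obtain ⟨w', hw', hR⟩ := total w hw
      refine ⟨quotientSpace.mk w' hw', fun z hz z' hz' hR' e => ?_⟩
      obtain ⟨t, ht, h⟩ := quotientSpace.mk_eq_mk.1 e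
      exact quotientSpace.mk_eq_mk.2 (compat w hw t ht z h w' z' hR hR')
  choose f hf using this
  exact ⟨f, fun z hz z' hz' hR => hf _ z hz z' hz' hR rfl⟩

end StableLocus

/-! ### Roots of unity -/

section RootsOfUnity

theorem exists_root_of_pow_eq {r : ℕ} (hr : 0 < r) {x y : ℂ} (h : x ^ r = y ^ r) :
    ∃ η : ℂˣ, η ^ r = 1 ∧ x = η * y := by
  by_cases hy : y = 0
  · subst hy
    rw [zero_pow hr.ne'] at h
    exact ⟨1, one_pow _, by simpa using pow_eq_zero_iff hr.ne' |>.1 h⟩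
  · have hx : x ≠ 0 := by
      rintro rfl
      rw [zero_pow hr.ne', eq_comm, pow_eq_zero_iff hr.ne'] at h
      exact hy h
    refine ⟨Units.mk0 (x / y) (div_ne_zero hx hy), Units.ext ?_, ?_⟩
    · simp [div_pow, h, hy]
    · simp [hy]

/-- Tested on a primitive root, of order exactly $r$. This turns equality of characters of $\mu_r$
into congruences of exponents. -/
theorem modEq_of_forall_root {r : ℕ} (hr : 0 < r) {p q : ℕ}
    (h : ∀ ε : ℂˣ, ε ^ r = 1 → (ε : ℂ) ^ p = (ε : ℂ) ^ q) : p ≡ q [MOD r] := by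
  have hprim := Complex.isPrimitiveRoot_exp r hr.ne'
  let ε := Units.mk0 _ (hprim.ne_zero hr.ne')
  have hε : orderOf ε = r := by
    rw [← orderOf_units]
    exact hprim.eq_orderOf.symm
  have := h ε (hε ▸ pow_orderOf_eq_one ε)
  rw [← hε, ← pow_eq_pow_iff_modEq]
  exact Units.ext (by simpa using this)

end RootsOfUnity

/-! ### The chart $x_1=y_k=1$ of the bundle -/

section Chart

theorem zpow_finset_sum {M κ : Type*} [CommGroup M] (x : M) (S : Finset κ) (f : κ → ℤ) :
    x ^ ∑ i ∈ S, f i = ∏ i ∈ S, x ^ f i := by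
  induction S using Finset.cons_induction with
  | empty => simp
  | cons i S hi ih => rw [Finset.sum_cons, Finset.prod_cons, zpow_add, ih]

theorem mul_inv_mul_inv_cancel {M : Type*} [CommGroup M] (p q r s t u : M) :
    p⁻¹ * (q * (r⁻¹ * s⁻¹)) = q * t⁻¹ * u⁻¹ * (t * p⁻¹ * r⁻¹ * (u * s⁻¹)) := by
  rw [show q * t⁻¹ * u⁻¹ * (t * p⁻¹ * r⁻¹ * (u * s⁻¹)) =
    (t⁻¹ * t) * (u⁻¹ * u) * (p⁻¹ * (q * (r⁻¹ * s⁻¹))) by ac_rfl]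
  simp

variable {m : ℕ} {ω a b : Fin (m + 1) → ℕ} {k : Fin (m + 1)}

@[simp]
theorem chartPoint_inl_one (z : ChartVar k → ℂ) : chartPoint z (Sum.inl 1) = 1 := by
  simp [chartPoint]

@[simp]
theorem chartPoint_inr_self (z : ChartVar k → ℂ) : chartPoint z (Sum.inr k) = 1 := by
  simp [chartPoint]

@[simp]
theorem chartPoint_coe (z : ChartVar k → ℂ) (v : ChartVar k) : chartPoint z v.1 = z v := by
  simp [chartPoint, v.2]

theorem forall_bundleVar (k : Fin (m + 1)) {p : BundleVar m → Prop} (h1 : p (Sum.inl 1))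
    (hk : p (Sum.inr k)) (h : ∀ v : ChartVar k, p v.1) (v : BundleVar m) : p v := by
  by_cases hv : v ≠ Sum.inl 1 ∧ v ≠ Sum.inr k
  · exact h ⟨v, hv⟩
  · rw [not_and_or, not_not, not_not] at hv
    rcases hv with rfl | rfl
    · exact h1
    · exact hk

@[simp]
theorem blowUpWeight_inl_one : blowUpWeight k b (Sum.inl 1) = 0 := by simp [blowUpWeight]

@[simp]
theorem blowUpWeight_inr_self : blowUpWeight k b (Sum.inr k) = 0 := by simp [blowUpWeight]

theorem blowUpWeight_modEq_chartType (hbi : ∀ i, i ≠ k → b i ≡ a i [MOD a k])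
    (hbk : ∃ r : ℕ, 0 < r ∧ b k = r * a k) (v : ChartVar k) :
    blowUpWeight k b v.1 ≡ chartType a k v [MOD a k] := by
  obtain ⟨r, -, hr⟩ := hbk
  obtain ⟨v | v, h1, h2⟩ := v
  · fin_cases v
    · simp [blowUpWeight, chartType, hr, Nat.modEq_zero_iff_dvd]
    · exact absurd rfl h1
  · have hv : v ≠ k := fun h => h2 (h ▸ rfl)
    simpa [blowUpWeight, chartType, hv] using hbi v hv

/-- Fixing $x_1=y_k=1$ leaves $s=1$ and $t^{a_k}=1$, so the residual group on the slice is
$\mu_{a_k}$. -/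
theorem exists_root_of_mem_group {g : BundleVar m → ℂˣ} (hg : g ∈ (weightedBundle ω a).group)
    (h1 : g (Sum.inl 1) = 1) (hk : g (Sum.inr k) = 1) :
    ∃ ε : ℂˣ, ε ^ a k = 1 ∧ ∀ v : ChartVar k, g v.1 = ε ^ chartType a k v := by
  obtain ⟨s, t, hs, ht⟩ := mem_weightedBundle_group.1 hg
  have hs1 : s = 1 := by rw [← hs 1, h1]
  subst hs1
  simp only [one_zpow, one_mul] at ht
  refine ⟨t, by rw [← ht, hk], ?_⟩
  rintro ⟨v | v, -⟩
  · simp [hs, chartType]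
  · simp [ht, chartType]

theorem exists_mem_group_of_root {ε : ℂˣ} (hε : ε ^ a k = 1) :
    ∃ g ∈ (weightedBundle ω a).group, g (Sum.inl 1) = 1 ∧ g (Sum.inr k) = 1 ∧
      ∀ v : ChartVar k, g v.1 = ε ^ chartType a k v := by
  refine ⟨Sum.elim (fun _ => 1) fun i => ε ^ a i,
    mem_weightedBundle_group.2 ⟨1, ε, fun _ => rfl, fun i => by simp⟩, rfl, hε, ?_⟩
  rintro ⟨v | v, -⟩ <;> simp [chartType]

theorem chartPoint_mem_stableLocus (z : ChartVar k → ℂ) :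
    chartPoint z ∈ stableLocus (weightedBundle ω a).irrelevantIdeal :=
  mem_stableLocus_weightedBundle.2 ⟨Or.inr (by simp), k, by simp⟩

/-- The weights of the variables in the first row of the weight matrix. -/
def fibreWeight (ω : Fin (m + 1) → ℕ) : BundleVar m → ℤ :=
  Sum.elim (fun _ => 1) fun i => -(ω i : ℤ)

/-- Setting `x_1 = y_k = 1`, with the help of the torus, turns monomials of the same weight under
`μ_{a_k}` into polynomials, up to a common factor. -/
theorem exists_normalized_polynomial (ω : Fin (m + 1) → ℕ) (ha : ∀ i, 0 < a i) {D : Type*}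
    (S : Finset D) (e : D → ChartVar k → ℕ) (j : ℕ)
    (hj : ∀ d ∈ S, (∑ v, chartType a k v * e d v) % a k = j) :
    ∃ E : D → MvPolynomial (BundleVar m) ℂ, ∀ z : BundleVar m → ℂ, z (Sum.inl 1) ≠ 0 →
      z (Sum.inr k) ≠ 0 → ∃ g ∈ (weightedBundle ω a).group,
        (g (Sum.inl 1) : ℂ) * z (Sum.inl 1) = 1 ∧ (g (Sum.inr k) : ℂ) * z (Sum.inr k) = 1 ∧
        ∃ μ : ℂ, μ ≠ 0 ∧ ∀ d ∈ S,
          ∏ v : ChartVar k, ((g v.1 : ℂ) * z v.1) ^ e d v = μ * eval z (E d) := by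
  -- The $\mu_{a_k}$-weight of $d$ is $j+a_kn_d$. The normalised monomial is the original one times
  -- $t^j x^{-(f_d+\omega_kn_d)}y^{-n_d}$; the uniform bound $M$ clears the negative exponents of
  -- $x,y$ at the cost of the common factor $\mu=t^jx^{-M}y^{-M}$.
  let n : D → ℕ := fun d => (∑ v, chartType a k v * e d v) / a k
  let f : D → ℤ := fun d => ∑ v : ChartVar k, fibreWeight ω v.1 * e d v
  let M : ℕ := ∑ d ∈ S, ((f d + ω k * n d).natAbs + n d)
  have hM : ∀ d ∈ S, f d + ω k * n d ≤ M ∧ n d ≤ M := fun d hd => by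
    have : (f d + ω k * n d).natAbs + n d ≤ M :=
      Finset.single_le_sum (f := fun d => (f d + ω k * n d).natAbs + n d)
        (fun _ _ => Nat.zero_le _) hd
    omega
  refine ⟨fun d => X (Sum.inl 1) ^ (M - (f d + ω k * n d)).toNat * X (Sum.inr k) ^ (M - n d) *
    ∏ v : ChartVar k, X v.1 ^ e d v, fun z hx hy => ?_⟩
  let x := Units.mk0 _ hx
  let y := Units.mk0 _ hy
  -- With $s=x^{-1}$, the torus scales $y_k$ by $x^{\omega_k}t^{a_k}$, which must equal $y^{-1}$.
  obtain ⟨t, ht⟩ := exists_unit_pow_eq (ha k) (x ^ ω k * y)⁻¹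
  refine ⟨Sum.elim (fun _ => x⁻¹) fun i => x⁻¹ ^ (-(ω i : ℤ)) * t ^ a i,
    mem_weightedBundle_group.2 ⟨x⁻¹, t, fun _ => rfl, fun _ => rfl⟩, ?_, ?_,
    ((t ^ j * (x ^ M)⁻¹ * (y ^ M)⁻¹ : ℂˣ) : ℂ), Units.ne_zero _, fun d hd => ?_⟩
  · simp [x, hx]
  · rw [Sum.elim_inr, ht]
    simp [x, y, hy]
  · have hg : ∀ v : ChartVar k, (Sum.elim (fun _ => x⁻¹) (fun i => x⁻¹ ^ (-(ω i : ℤ)) * t ^ a i)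
        v.1 : ℂˣ) = x⁻¹ ^ fibreWeight ω v.1 * t ^ chartType a k v := by
      rintro ⟨v | v, -⟩ <;> simp [fibreWeight, chartType]
    have hprod : ∏ v : ChartVar k, (x⁻¹ ^ fibreWeight ω v.1 * t ^ chartType a k v) ^ e d v =
        t ^ j * (x ^ M)⁻¹ * (y ^ M)⁻¹ *
          (x ^ (M - (f d + ω k * n d)).toNat * y ^ (M - n d)) := by
      have e1 : ∏ v : ChartVar k, (x⁻¹ ^ fibreWeight ω v.1 * t ^ chartType a k v) ^ e d v =
          x⁻¹ ^ f d * t ^ ∑ v, chartType a k v * e d v := by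
        simp only [mul_pow, Finset.prod_mul_distrib, ← pow_mul, f]
        rw [Finset.prod_pow_eq_pow_sum]
        congr 1
        rw [zpow_finset_sum]
        exact Finset.prod_congr rfl fun v _ => by rw [zpow_mul, zpow_natCast]
      have e2 : t ^ ∑ v, chartType a k v * e d v = t ^ j * ((x ^ ω k * y) ^ n d)⁻¹ := by
        rw [← inv_pow, ← ht, ← pow_mul, ← pow_add, ← hj d hd, Nat.mod_add_div]
      have e3 : x ^ (M - (f d + ω k * n d)).toNat =
          x ^ M * (x ^ f d)⁻¹ * ((x ^ ω k) ^ n d)⁻¹ := by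
        rw [← zpow_natCast, Int.toNat_of_nonneg (by have := (hM d hd).1; omega), zpow_sub, zpow_add,
          zpow_natCast, mul_inv, ← mul_assoc, zpow_mul, zpow_natCast, zpow_natCast]
      have e4 : y ^ (M - n d) = y ^ M * (y ^ n d)⁻¹ := pow_sub y (hM d hd).2
      rw [e1, e2, e3, e4, inv_zpow, mul_pow, mul_inv]
      exact mul_inv_mul_inv_cancel _ _ _ _ _ _
    have hprod' := congrArg (Units.val : ℂˣ → ℂ) hprod
    simp only [hg, mul_pow, Finset.prod_mul_distrib, map_mul, map_pow, map_prod, eval_X]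
    rw [← mul_assoc]
    congr 1
    simpa [x, y] using hprod'

theorem exists_normalizing (ω : Fin (m + 1) → ℕ) (ha : ∀ i, 0 < a i) {z : BundleVar m → ℂ}
    (h1 : z (Sum.inl 1) ≠ 0) (hk : z (Sum.inr k) ≠ 0) : ∃ g ∈ (weightedBundle ω a).group,
      (g (Sum.inl 1) : ℂ) * z (Sum.inl 1) = 1 ∧ (g (Sum.inr k) : ℂ) * z (Sum.inr k) = 1 := by
  -- With no monomials to rewrite, only the normalising torus element remains.
  obtain ⟨_, h⟩ := exists_normalized_polynomial (k := k) ω ha (∅ : Finset ℕ) (fun _ _ => 0) 0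
    (by simp)
  obtain ⟨g, hg, h1', hk', -⟩ := h z h1 hk
  exact ⟨g, hg, h1', hk'⟩

theorem chartPoint_eq_smul {z : BundleVar m → ℂ} {g : BundleVar m → ℂˣ}
    (h1 : (g (Sum.inl 1) : ℂ) * z (Sum.inl 1) = 1)
    (hk : (g (Sum.inr k) : ℂ) * z (Sum.inr k) = 1) (v : BundleVar m) :
    chartPoint (fun v : ChartVar k => (g v.1 : ℂ) * z v.1) v = g v * z v :=
  forall_bundleVar k (p := fun v => chartPoint (fun v : ChartVar k => (g v.1 : ℂ) * z v.1) v =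
    g v * z v) (by rw [chartPoint_inl_one, h1]) (by rw [chartPoint_inr_self, hk])
    (fun v => chartPoint_coe _ _) v

theorem eval_ite_X (z : ChartVar k → ℂ) (v : BundleVar m) :
    eval z (if h : v ≠ Sum.inl 1 ∧ v ≠ Sum.inr k then X ⟨v, h⟩ else 1) = chartPoint z v := by
  by_cases h : v ≠ Sum.inl 1 ∧ v ≠ Sum.inr k <;> simp [chartPoint, h]

theorem SameWeight.cyclicGroup_modEq {δ : Type} [Fintype δ] {r : ℕ} (hr : 0 < r) {c : δ → ℕ}
    {S : Finset (δ →₀ ℕ)} (hS : SameWeight (cyclicGroup r c) S) {d d' : δ →₀ ℕ} (hd : d ∈ S)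
    (hd' : d' ∈ S) : ∑ v, c v * d v ≡ ∑ v, c v * d' v [MOD r] := by
  refine modEq_of_forall_root hr fun ε hε => ?_
  have := DFunLike.congr_fun (hS d hd d' hd') ⟨fun v => ε ^ c v, ε, hε, fun _ => rfl⟩
  simpa [monomialChar, ← pow_mul, Finset.prod_pow_eq_pow_sum] using this

/-- The chart `ℂ^{m+1} / μ_{a_k}` of the bundle. -/
theorem exists_chart (ha : ∀ i, 0 < a i) (k : Fin (m + 1)) :
    ∃ φ : cyclicQuotient (a k) (chartType a k) → (weightedBundle ω a).variety,
      (∀ z hz, φ (cyclicQuotient.mk z) = quotientSpace.mk (chartPoint z) hz) ∧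
      (∀ z hz, quotientSpace.mk z hz ∈ Set.range φ ↔ z (Sum.inl 1) ≠ 0 ∧ z (Sum.inr k) ≠ 0) ∧
      IsOpenImmersionOn φ Set.univ := by
  obtain ⟨φ, hφ⟩ := exists_quotient_map (I := ⊤) (G := cyclicGroup (a k) (chartType a k))
    (I' := (weightedBundle ω a).irrelevantIdeal) (G' := (weightedBundle ω a).group)
    (fun z z' => z' = chartPoint z) (fun z _ => ⟨_, chartPoint_mem_stableLocus z, rfl⟩) (by
      rintro z - s ⟨ε, hε, hs⟩ w hw _ _ rfl rfl
      obtain ⟨g, hg, h1, hk, hv⟩ := exists_mem_group_of_root (ω := ω) hε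
      refine ⟨g, hg, forall_bundleVar k ?_ ?_ fun v => ?_⟩
      · simp [h1]
      · simp [hk]
      · rw [chartPoint_coe, chartPoint_coe, hw, hs, hv])
  replace hφ : ∀ z hz hz', φ (quotientSpace.mk z hz) = quotientSpace.mk (chartPoint z) hz' :=
    fun z hz hz' => hφ z hz _ hz' rfl
  refine ⟨φ, fun z hz => hφ z _ hz, fun z hz => ⟨?_, ?_⟩, ?_⟩
  · rintro ⟨x, hx⟩
    induction x using quotientSpace.ind with
    | h y hy =>
      rw [hφ y hy (chartPoint_mem_stableLocus y)] at hx
      obtain ⟨t, -, h⟩ := quotientSpace.mk_eq_mk.1 hx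
      simp [h]
  · rintro ⟨h1, hk⟩
    obtain ⟨g, hg, h1', hk'⟩ := exists_normalizing ω ha h1 hk
    refine ⟨cyclicQuotient.mk fun v => g v.1 * z v.1, ?_⟩
    refine (hφ _ _ (chartPoint_mem_stableLocus _)).trans
      (quotientSpace.mk_eq_mk.2 ⟨g, hg, chartPoint_eq_smul h1' hk'⟩).symm
  · have hinj : Function.Injective φ := by
      intro x y hxy
      induction x using quotientSpace.ind with
      | h z hz =>
        induction y using quotientSpace.ind with
        | h w hw =>
          rw [hφ z hz (chartPoint_mem_stableLocus z), hφ w hw (chartPoint_mem_stableLocus w)] at hxy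
          obtain ⟨g, hg, h⟩ := quotientSpace.mk_eq_mk.1 hxy
          have h1 := h (Sum.inl 1)
          have hk := h (Sum.inr k)
          rw [chartPoint_inl_one, chartPoint_inl_one, mul_one, eq_comm, Units.val_eq_one] at h1
          rw [chartPoint_inr_self, chartPoint_inr_self, mul_one, eq_comm, Units.val_eq_one] at hk
          obtain ⟨ε, hε, hv⟩ := exists_root_of_mem_group hg h1 hk
          refine quotientSpace.mk_eq_mk.2 ⟨fun v => g v.1, ⟨ε, hε, hv⟩, fun v => ?_⟩
          simpa using h v.1
    refine isOpenImmersionOn_of_transfer (fun z _ t => mem_stableLocus_top _)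
      (isMorphism_of_polynomial (fun z hz => smul_mem_weightedBundle hz)
        (fun v => if h : v ≠ Sum.inl 1 ∧ v ≠ Sum.inr k then X ⟨v, h⟩ else 1) fun z hz => ?_)
      isOpen_univ hinj.injOn ?_
    · simp only [eval_ite_X]
      exact ⟨chartPoint_mem_stableLocus z, hφ z hz _⟩
    · rintro S hS w - w' hw' ⟨hw, _, -, hww⟩ ⟨d₀, hd₀, -⟩
      obtain ⟨E, hE⟩ := exists_normalized_polynomial ω ha S (fun d => d) _
        fun d hd => hS.cyclicGroup_modEq (ha k) hd hd₀
      refine ⟨X (Sum.inl 1) * X (Sum.inr k), E, ?_, fun z' hz' hne => ?_⟩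
      · rw [hφ w hw (chartPoint_mem_stableLocus w)] at hww
        obtain ⟨t, -, h⟩ := quotientSpace.mk_eq_mk.1 hww
        simp [h]
      · rw [map_mul, eval_X, eval_X] at hne
        obtain ⟨g, hg, h1', hk', μ, hμ, h⟩ :=
          hE z' (left_ne_zero_of_mul hne) (right_ne_zero_of_mul hne)
        refine ⟨fun v => g v.1 * z' v.1, mem_stableLocus_top _,
          ⟨mem_stableLocus_top _, hz', trivial, ?_⟩, μ, hμ, h⟩
        exact (hφ _ _ (chartPoint_mem_stableLocus _)).trans
          (quotientSpace.mk_eq_mk.2 ⟨g, hg, chartPoint_eq_smul h1' hk'⟩).symm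

end Chart

/-! ### The blow up morphism and its chart -/

section BlowUp

variable {m : ℕ} {ω a b : Fin (m + 1) → ℕ} {k : Fin (m + 1)}

/-- The coordinates `(X_0 ζ^{b_k} : X_1; … : Y_i ζ^{b_i} : … : Y_k : …)`. -/
def blowDown (k : Fin (m + 1)) (b : Fin (m + 1) → ℕ) (z : BlowUpVar m → ℂ) (ζ : ℂ) :
    BundleVar m → ℂ :=
  fun v => ζ ^ blowUpWeight k b v * z (some v)

/-- When $\xi=0$, the factors $(\xi,X_1)$ and $(\xi,Y_k)$ of $J$ keep $x_1$ and $y_k$ nonzero;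
otherwise all coordinates are only rescaled. -/
theorem blowDown_mem_stableLocus (ha : ∀ i, 0 < a i) {z : BlowUpVar m → ℂ}
    (hz : z ∈ stableLocus (rankThreeStack ω a k b).irrelevantIdeal) {ζ : ℂ}
    (hζ : ζ ^ a k = z none) :
    blowDown k b z ζ ∈ stableLocus (weightedBundle ω a).irrelevantIdeal := by
  rw [mem_stableLocus_rankThreeStack] at hz
  rw [mem_stableLocus_weightedBundle]
  by_cases h0 : ζ = 0
  · subst h0
    rw [zero_pow (ha k).ne'] at hζ
    exact ⟨Or.inr (by simpa [blowDown] using hz.2.1.resolve_left (not_not.2 hζ.symm)),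
      k, by simpa [blowDown] using hz.2.2.1.resolve_left (not_not.2 hζ.symm)⟩
  · simpa [blowDown, h0] using hz.1

theorem chartVar_blowUpWeight_ne_zero (hb : ∀ i, 0 < b i) (v : ChartVar k) :
    blowUpWeight k b v.1 ≠ 0 :=
  (blowUpWeight_ne_zero_iff hb).2 v.2

theorem basePoint_eq : basePoint k = chartPoint (0 : ChartVar k → ℂ) := by
  funext v
  refine forall_bundleVar k (p := fun v => basePoint k v = chartPoint (0 : ChartVar k → ℂ) v)
    (by simp [basePoint]) (by simp [basePoint]) (fun v => ?_) v
  rw [chartPoint_coe]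
  obtain ⟨v | v, h1, h2⟩ := v
  · fin_cases v
    · simp [basePoint]
    · exact absurd rfl h1
  · have : v ≠ k := fun h => h2 (h ▸ rfl)
    simp [basePoint, this]

/-- The point of the blow up of the bundle with coordinate `z` on the base and `ξ = 1`. -/
theorem elim_one_mem_stableLocus {z : BundleVar m → ℂ}
    (hz : z ∈ stableLocus (weightedBundle ω a).irrelevantIdeal) {v : ChartVar k}
    (hv : z v.1 ≠ 0) :
    (fun i => Option.elim i 1 z : BlowUpVar m → ℂ) ∈
      stableLocus (rankThreeStack ω a k b).irrelevantIdeal := by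
  rw [mem_stableLocus_weightedBundle] at hz
  rw [mem_stableLocus_rankThreeStack]
  exact ⟨hz, Or.inl one_ne_zero, Or.inl one_ne_zero, v, hv⟩

theorem SameWeight.weightedBundle_modEq (ha : ∀ i, 0 < a i)
    (hbi : ∀ i, i ≠ k → b i ≡ a i [MOD a k]) (hbk : ∃ r : ℕ, 0 < r ∧ b k = r * a k)
    {S : Finset (BundleVar m →₀ ℕ)} (hS : SameWeight (weightedBundle ω a).group S)
    {d d' : BundleVar m →₀ ℕ} (hd : d ∈ S) (hd' : d' ∈ S) :
    ∑ v, blowUpWeight k b v * d v ≡ ∑ v, blowUpWeight k b v * d' v [MOD a k] := by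
  refine modEq_of_forall_root (ha k) fun ε hε => ?_
  have := DFunLike.congr_fun (hS d hd d' hd')
    ⟨fun v => ε ^ blowUpWeight k b v, pow_blowUpWeight_mem_group hbi hbk hε⟩
  simpa only [monomialChar, MonoidHom.coe_mk, OneHom.coe_mk, Units.val_pow_eq_pow_val, ← pow_mul,
    Finset.prod_pow_eq_pow_sum] using this

/-- Division with remainder separates the fractional power of $\xi$ from a polynomial. By
`SameWeight.weightedBundle_modEq` the remainder is constant on monomials of equal weight, so the
fractional power is the common factor of the transfer. -/
theorem monomialValue_blowDown (z : BlowUpVar m → ℂ) {ζ : ℂ} (hζ : ζ ^ a k = z none)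
    (d : BundleVar m →₀ ℕ) :
    monomialValue (blowDown k b z ζ) d = ζ ^ ((∑ v, blowUpWeight k b v * d v) % a k) *
      (z none ^ ((∑ v, blowUpWeight k b v * d v) / a k) * ∏ v, z (some v) ^ d v) := by
  simp only [monomialValue, blowDown, mul_pow, Finset.prod_mul_distrib, ← pow_mul,
    Finset.prod_pow_eq_pow_sum]
  rw [← hζ, ← mul_assoc, ← pow_mul, ← pow_add, Nat.mod_add_div]

/-- The blow up morphism. -/
theorem exists_blowDown (ha : ∀ i, 0 < a i) (hb : ∀ i, 0 < b i)
    (hbi : ∀ i, i ≠ k → b i ≡ a i [MOD a k]) (hbk : ∃ r : ℕ, 0 < r ∧ b k = r * a k) :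
    ∃ (π : (rankThreeStack ω a k b).variety → (weightedBundle ω a).variety)
      (p : (weightedBundle ω a).variety),
      (∀ h, p = quotientSpace.mk (basePoint k) h) ∧
      (∀ z hz ζ hz', ζ ^ a k = z none →
        π (quotientSpace.mk z hz) = quotientSpace.mk (blowDown k b z ζ) hz') ∧
      (∀ z hz, π (quotientSpace.mk z hz) = p ↔ z none = 0) ∧
      IsOpenImmersionOn π (π ⁻¹' {p}ᶜ) ∧ Function.Surjective π := by
  have hak := (ha k).ne'
  obtain ⟨π, hπ⟩ := exists_quotient_map (I := (rankThreeStack ω a k b).irrelevantIdeal)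
    (G := (rankThreeStack ω a k b).group)
    (I' := (weightedBundle ω a).irrelevantIdeal) (G' := (weightedBundle ω a).group)
    (fun z z' => ∃ ζ : ℂ, ζ ^ a k = z none ∧ z' = blowDown k b z ζ)
    (fun z hz => by
      obtain ⟨ζ, hζ⟩ := IsAlgClosed.exists_pow_nat_eq (z none) (ha k)
      exact ⟨_, blowDown_mem_stableLocus ha hz hζ, ζ, hζ, rfl⟩) (by
      rintro z hz t ht w hw _ _ ⟨ζ, hζ, rfl⟩ ⟨ζ', hζ', rfl⟩
      obtain ⟨g, hg, u, h1, h2⟩ := mem_rankThreeStack_group.1 ht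
      -- Both $\zeta'$ and $u^{-1}\zeta$ are roots of the new value $u^{-a_k}\xi$; the discrepancy
      -- $\eta$ acts through the group of the bundle.
      obtain ⟨η, hη, e⟩ := exists_root_of_pow_eq (ha k) (x := ζ') (y := (u⁻¹ : ℂˣ) * ζ) (by
        rw [hζ', hw, h2, mul_pow, hζ]
        simp)
      refine ⟨_, mul_mem (pow_blowUpWeight_mem_group hbi hbk hη) hg, fun v => ?_⟩
      simp only [blowDown, hw, h1, e, mul_pow, Pi.mul_apply, Units.val_mul,
        Units.val_pow_eq_pow_val, Units.val_inv_eq_inv_val, inv_pow]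
      have := pow_ne_zero (blowUpWeight k b v) u.ne_zero
      field_simp)
  replace hπ : ∀ z hz ζ hz', ζ ^ a k = z none →
        π (quotientSpace.mk z hz) = quotientSpace.mk (blowDown k b z ζ) hz' :=
    fun z hz ζ hz' hζ => hπ z hz _ hz' ⟨ζ, hζ, rfl⟩
  have hbase : basePoint k ∈ stableLocus (weightedBundle ω a).irrelevantIdeal :=
    basePoint_eq (k := k) ▸ chartPoint_mem_stableLocus _
  have hp : ∀ z hz, π (quotientSpace.mk z hz) = quotientSpace.mk (basePoint k) hbase ↔
      z none = 0 := by
    intro z hz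
    obtain ⟨ζ, hζ⟩ := IsAlgClosed.exists_pow_nat_eq (z none) (ha k)
    rw [hπ z hz ζ (blowDown_mem_stableLocus ha hz hζ) hζ]
    rw [mem_stableLocus_rankThreeStack] at hz
    constructor
    · intro h
      obtain ⟨t, -, ht⟩ := quotientSpace.mk_eq_mk.1 h
      -- By the last factor of $J$ some local coordinate is nonzero upstairs. It vanishes at $p$ and
      -- has positive weight, which forces $\zeta=0$.
      obtain ⟨v, hv⟩ := hz.2.2.2
      have := ht v.1
      rw [basePoint_eq, chartPoint_coe] at this
      simp only [Pi.zero_apply, blowDown, zero_eq_mul, mul_eq_zero, Units.ne_zero, false_or, hv,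
        or_false,
        pow_eq_zero_iff (chartVar_blowUpWeight_ne_zero hb v)] at this
      rw [← hζ, this, zero_pow hak]
    · intro h0
      have hζ0 : ζ = 0 := by
        rwa [h0, pow_eq_zero_iff hak] at hζ
      subst hζ0
      obtain ⟨g, hg, h1, hk⟩ := exists_normalizing (k := k) ω ha (z := blowDown k b z 0)
        (by simpa [blowDown] using hz.2.1.resolve_left (not_not.2 h0))
        (by simpa [blowDown] using hz.2.2.1.resolve_left (not_not.2 h0))
      refine quotientSpace.mk_eq_mk.2 ⟨g, hg, fun v => ?_⟩
      rw [← chartPoint_eq_smul h1 hk, basePoint_eq]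
      congr 1
      funext v
      simp [blowDown, zero_pow (chartVar_blowUpWeight_ne_zero hb v)]
  have hmor : IsMorphism π := by
    refine isMorphism_of_transfer (fun z hz => smul_mem_weightedBundle hz) ?_
    rintro S hS w' - w - ⟨hw, hw', hww⟩ ⟨d₀, hd₀, hne⟩
    obtain ⟨ζ, hζ⟩ := IsAlgClosed.exists_pow_nat_eq (w none) (ha k)
    -- This factor is nonzero at $w$ even on $\xi=0$: a nonvanishing monomial `d₀` then forces its
    -- residue to be $0$.
    refine ⟨X none ^ ((∑ v, blowUpWeight k b v * d₀ v) % a k),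
      fun d => X none ^ ((∑ v, blowUpWeight k b v * d v) / a k) * ∏ v, X (some v) ^ d v,
      ?_, fun z hz hzN => ?_⟩
    · rw [hπ w hw ζ (blowDown_mem_stableLocus ha hw hζ) hζ] at hww
      obtain ⟨t, ht, h⟩ := quotientSpace.mk_eq_mk.1 hww
      rw [monomialValue_smul ht h, monomialValue_blowDown w hζ] at hne
      have := left_ne_zero_of_mul (right_ne_zero_of_mul hne)
      rw [map_pow, eval_X, ← hζ, pow_right_comm]
      exact pow_ne_zero _ this
    · obtain ⟨ξ, hξ⟩ := IsAlgClosed.exists_pow_nat_eq (z none) (ha k)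
      refine ⟨_, blowDown_mem_stableLocus ha hz hξ,
        ⟨hz, blowDown_mem_stableLocus ha hz hξ, hπ z hz ξ _ hξ⟩,
        ξ ^ ((∑ v, blowUpWeight k b v * d₀ v) % a k), ?_, fun d hd => ?_⟩
      · rw [map_pow, eval_X, ← hξ, pow_right_comm] at hzN
        exact (pow_ne_zero_iff hak).1 hzN
      · rw [monomialValue_blowDown z hξ, hS.weightedBundle_modEq ha hbi hbk hd hd₀]
        simp
  have hmem : ∀ z hz, quotientSpace.mk z hz ∈
      π ⁻¹' {(quotientSpace.mk (basePoint k) hbase : (weightedBundle ω a).variety)}ᶜ ↔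
        z none ≠ 0 := fun z hz => not_congr (hp z hz)
  have hone : ∀ (z : BundleVar m → ℂ) hz hz',
      π (quotientSpace.mk (fun i => Option.elim i 1 z) hz) = quotientSpace.mk z hz' := by
    intro z hz hz'
    have e : z = blowDown k b (fun i => Option.elim i 1 z) 1 := by
      funext v
      simp [blowDown]
    exact (hπ _ hz 1 (e ▸ hz') (one_pow _)).trans (by congr 1; exact e.symm)
  refine ⟨π, quotientSpace.mk (basePoint k) hbase, fun _ => rfl, hπ, hp, ?_, ?_⟩
  · refine isOpenImmersionOn_of_transfer (fun z hz => smul_mem_rankThreeStack hz) hmor ?_ ?_ ?_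
    · rw [quotientSpace.isOpen_iff]
      intro z hz h
      exact ⟨X none, by simpa using (hmem z hz).1 h,
        fun w hw h => (hmem w hw).2 (by simpa using h)⟩
    · intro x hx y hy hxy
      induction x using quotientSpace.ind with
      | h z hz =>
        induction y using quotientSpace.ind with
        | h w hw =>
          rw [hmem] at hx hy
          obtain ⟨ζ, hζ⟩ := IsAlgClosed.exists_pow_nat_eq (z none) (ha k)
          obtain ⟨ξ, hξ⟩ := IsAlgClosed.exists_pow_nat_eq (w none) (ha k)
          have hζ0 : ζ ≠ 0 := fun h => hx (by rw [← hζ, h, zero_pow hak])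
          have hξ0 : ξ ≠ 0 := fun h => hy (by rw [← hξ, h, zero_pow hak])
          rw [hπ z hz ζ (blowDown_mem_stableLocus ha hz hζ) hζ,
            hπ w hw ξ (blowDown_mem_stableLocus ha hw hξ) hξ] at hxy
          obtain ⟨g, hg, h⟩ := quotientSpace.mk_eq_mk.1 hxy
          -- The ratio of the chosen roots supplies the third torus parameter.
          let u : ℂˣ := Units.mk0 ζ hζ0 / Units.mk0 ξ hξ0
          refine quotientSpace.mk_eq_mk.2 ⟨fun i => Option.elim i (u ^ a k)⁻¹ fun v =>
            g v * u ^ blowUpWeight k b v, mem_rankThreeStack_group.2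
              ⟨g, hg, u, fun _ => rfl, rfl⟩, fun i => ?_⟩
          cases i with
          | none =>
            simp only [Option.elim, u, ← hζ, ← hξ, Units.val_inv_eq_inv_val,
              Units.val_pow_eq_pow_val, Units.val_div_eq_div_val, Units.val_mk0, div_pow]
            field_simp
          | some v =>
            have := h v
            simp only [blowDown] at this
            simp only [Option.elim, u, Units.val_mul, Units.val_pow_eq_pow_val,
              Units.val_div_eq_div_val, Units.val_mk0, div_pow]
            field_simp
            linear_combination this
    · rintro S hS w - w' - ⟨hw, hw', hwW, hww⟩ -
      obtain ⟨ζ, hζ⟩ := IsAlgClosed.exists_pow_nat_eq (w none) (ha k)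
      have hζ0 : ζ ≠ 0 := fun h => (hmem w hw).1 hwW (by rw [← hζ, h, zero_pow hak])
      rw [hπ w hw ζ (blowDown_mem_stableLocus ha hw hζ) hζ] at hww
      obtain ⟨t, -, h⟩ := quotientSpace.mk_eq_mk.1 hww
      obtain ⟨v, hv⟩ := (mem_stableLocus_rankThreeStack.1 hw).2.2.2
      -- Where some local coordinate is nonzero, $z\mapsto(z,1)$ is a polynomial section of $\pi$,
      -- so monomials transfer by setting $\xi=1$.
      refine ⟨X v.1, fun d => ∏ i : BlowUpVar m, (i.elim 1 X) ^ d i, ?_, fun z' hz' hne => ?_⟩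
      · simp [h, blowDown, hζ0, hv]
      · rw [eval_X] at hne
        have hst := elim_one_mem_stableLocus (b := b) hz' hne
        refine ⟨_, hst, ⟨hst, hz', (hmem _ _).2 one_ne_zero, hone z' hst hz'⟩, 1, one_ne_zero,
          fun d _ => ?_⟩
        rw [one_mul, map_prod]
        refine Finset.prod_congr rfl fun i _ => ?_
        cases i <;> simp
  · intro y
    induction y using quotientSpace.ind with
    | h z hz =>
      by_cases hv : ∃ v : ChartVar k, z v.1 ≠ 0
      · obtain ⟨v, hv⟩ := hv
        exact ⟨_, hone z (elim_one_mem_stableLocus hz hv) hz⟩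
      · push Not at hv
        -- A point of the exceptional divisor: $X_0=X_1=Y_k=1$ and all other coordinates $0$, where
        -- $X_0\ne0$ satisfies the last factor of $J$.
        have hst : (fun i => Option.elim i 0 (Sum.elim 1 (Pi.single k 1)) : BlowUpVar m → ℂ) ∈
            stableLocus (rankThreeStack ω a k b).irrelevantIdeal := by
          rw [mem_stableLocus_rankThreeStack]
          exact ⟨⟨Or.inl (by simp), k, by simp⟩, Or.inr (by simp), Or.inr (by simp),
            ⟨Sum.inl 0, by simp⟩, by simp⟩
        refine ⟨quotientSpace.mk _ hst, ((hp _ hst).2 rfl).trans ?_⟩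
        have hz' := mem_stableLocus_weightedBundle.1 hz
        have h1 : z (Sum.inl 1) ≠ 0 := hz'.1.resolve_left
          (not_not.2 (hv ⟨Sum.inl 0, by simp⟩))
        have hk : z (Sum.inr k) ≠ 0 := by
          obtain ⟨i, hi⟩ := hz'.2
          by_cases hik : i = k
          · exact hik ▸ hi
          · exact absurd (hv ⟨Sum.inr i, by simpa using hik⟩) hi
        obtain ⟨g, hg, e1, ek⟩ := exists_normalizing ω ha h1 hk
        refine (quotientSpace.mk_eq_mk.2 ⟨g, hg, fun v => ?_⟩).symm
        rw [← chartPoint_eq_smul e1 ek, basePoint_eq]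
        congr 1
        funext v
        simp [hv v]

/-- The point of the blow up with `X_1 = Y_k = 1` and `ξ = u^r`, for the coordinates `(z, u)` of
the weighted blow up of the chart. -/
def liftedChartPoint {k : Fin (m + 1)} (r : ℕ) (z : Option (ChartVar k) → ℂ) : BlowUpVar m → ℂ :=
  fun i => i.elim (z none ^ r) (chartPoint fun v => z (some v))

theorem liftedChartPoint_mem_stableLocus {z : Option (ChartVar k) → ℂ}
    (hz : ∃ v, z (some v) ≠ 0) :
    liftedChartPoint (a k) z ∈ stableLocus (rankThreeStack ω a k b).irrelevantIdeal := by
  obtain ⟨v, hv⟩ := hz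
  rw [mem_stableLocus_rankThreeStack]
  exact ⟨⟨Or.inr (by simp [liftedChartPoint]), k, by simp [liftedChartPoint]⟩,
    Or.inr (by simp [liftedChartPoint]), Or.inr (by simp [liftedChartPoint]),
    v, by simpa [liftedChartPoint] using hv⟩

theorem SameWeight.weightedBlowUpGroup_modEq {δ : Type} [Fintype δ] {r : ℕ} (hr : 0 < r)
    {c b : δ → ℕ} {S : Finset (Option δ →₀ ℕ)} (hS : SameWeight (weightedBlowUpGroup r c b) S)
    {d d' : Option δ →₀ ℕ} (hd : d ∈ S) (hd' : d' ∈ S) :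
    ∑ v, c v * d (some v) ≡ ∑ v, c v * d' (some v) [MOD r] := by
  refine modEq_of_forall_root hr fun ε hε => ?_
  have := DFunLike.congr_fun (hS d hd d' hd')
    ⟨fun i => i.elim 1 fun v => ε ^ c v, 1, ε, hε, fun _ => by simp, by simp⟩
  simpa [monomialChar, Fintype.prod_option, ← pow_mul, Finset.prod_pow_eq_pow_sum] using this

/-- As $b\equiv c$ modulo $r$, the element $(t,\varepsilon)=(\varepsilon^{-1},\varepsilon)$ fixes
every $z_v$ and multiplies $u$ by $\varepsilon$. Homogeneous fractions therefore depend on $u$ only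
through $u^r$, which for $r=a_k$ is $\xi$. -/
theorem SameWeight.weightedBlowUpGroup_none_modEq {δ : Type} [Fintype δ] {r : ℕ} (hr : 0 < r)
    {c b : δ → ℕ} (hcb : ∀ v, b v ≡ c v [MOD r]) {S : Finset (Option δ →₀ ℕ)}
    (hS : SameWeight (weightedBlowUpGroup r c b) S)
    {d d' : Option δ →₀ ℕ} (hd : d ∈ S) (hd' : d' ∈ S) : d none ≡ d' none [MOD r] := by
  refine modEq_of_forall_root hr fun ε hε => ?_
  have := DFunLike.congr_fun (hS d hd d' hd')
    ⟨fun i => i.elim ε 1, ε⁻¹, ε, hε, fun v => by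
      rw [inv_pow, pow_eq_pow_of_modEq (hcb v) hε]
      simp, by simp⟩
  simpa [monomialChar, Fintype.prod_option] using this

/-- The chart of the blow up over the chart of the bundle. -/
theorem exists_liftedChart (ha : ∀ i, 0 < a i)
    (hbi : ∀ i, i ≠ k → b i ≡ a i [MOD a k]) (hbk : ∃ r : ℕ, 0 < r ∧ b k = r * a k) :
    ∃ ψ : weightedBlowUp (a k) (chartType a k) (fun v : ChartVar k => blowUpWeight k b v.1) →
        (rankThreeStack ω a k b).variety,
      (∀ z hz hz', ψ (quotientSpace.mk z hz) = quotientSpace.mk (liftedChartPoint (a k) z) hz') ∧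
      (∀ z hz, quotientSpace.mk z hz ∈ Set.range ψ ↔
        z (some (Sum.inl 1)) ≠ 0 ∧ z (some (Sum.inr k)) ≠ 0) ∧
      IsOpenImmersionOn ψ Set.univ := by
  have hcb := blowUpWeight_modEq_chartType hbi hbk
  have hlift : ∀ z ∈ stableLocus (Ideal.span (Set.range fun v : ChartVar k =>
      (X (some v) : MvPolynomial (Option (ChartVar k)) ℂ))),
      liftedChartPoint (a k) z ∈ stableLocus (rankThreeStack ω a k b).irrelevantIdeal :=
    fun z hz => liftedChartPoint_mem_stableLocus (mem_stableLocus_weightedBlowUp.1 hz)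
  obtain ⟨ψ, hψ⟩ := exists_quotient_map
    (I := Ideal.span (Set.range fun v : ChartVar k => (X (some v) : MvPolynomial _ ℂ)))
    (G := weightedBlowUpGroup (a k) (chartType a k) fun v : ChartVar k => blowUpWeight k b v.1)
    (I' := (rankThreeStack ω a k b).irrelevantIdeal) (G' := (rankThreeStack ω a k b).group)
    (fun z z' => z' = liftedChartPoint (a k) z) (fun z hz => ⟨_, hlift z hz, rfl⟩) (by
      rintro z - s ⟨t, ε, hε, hs, hn⟩ w hw _ _ rfl rfl
      obtain ⟨g, hg, h1, hk, hv⟩ := exists_mem_group_of_root (ω := ω) hε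
      refine ⟨fun i => Option.elim i (t ^ a k)⁻¹ fun v => g v * t ^ blowUpWeight k b v,
        mem_rankThreeStack_group.2 ⟨g, hg, t, fun _ => rfl, rfl⟩, fun i => ?_⟩
      cases i with
      | none => simp [liftedChartPoint, hw, hn, mul_pow]
      | some v =>
        simp only [liftedChartPoint, Option.elim]
        refine forall_bundleVar k (p := fun v => chartPoint (fun v => w (some v)) v =
          ((g v * t ^ blowUpWeight k b v : ℂˣ) : ℂ) * chartPoint (fun v => z (some v)) v)
          ?_ ?_ (fun v => ?_) v
        · simp [h1]
        · simp [hk]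
        · rw [chartPoint_coe, chartPoint_coe, hw, hs, hv, mul_comm (t ^ _)])
  replace hψ : ∀ z hz hz',
      ψ (quotientSpace.mk z hz) = quotientSpace.mk (liftedChartPoint (a k) z) hz' :=
    fun z hz hz' => hψ z hz _ hz' rfl
  -- Normalising $X_1=Y_k=1$ with the torus of the bundle leaves $\xi$ unchanged, and any $a_k$-th
  -- root of $\xi$ serves as $u$.
  have hnorm : ∀ (z : BlowUpVar m → ℂ) hz (g : BundleVar m → ℂˣ) (u : ℂ),
      g ∈ (weightedBundle ω a).group →
      (g (Sum.inl 1) : ℂ) * z (some (Sum.inl 1)) = 1 →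
      (g (Sum.inr k) : ℂ) * z (some (Sum.inr k)) = 1 → u ^ a k = z none →
      ∃ h, ψ (quotientSpace.mk (fun i => Option.elim i u fun v => (g v.1 : ℂ) * z (some v.1)) h) =
        quotientSpace.mk z hz := by
    intro z hz g u hg h1 hk hu
    have hmem : (fun i => Option.elim i u fun v => (g v.1 : ℂ) * z (some v.1)) ∈ stableLocus
        (Ideal.span (Set.range fun v : ChartVar k => (X (some v) : MvPolynomial _ ℂ))) := by
      rw [mem_stableLocus_weightedBlowUp]
      obtain ⟨v, hv⟩ := (mem_stableLocus_rankThreeStack.1 hz).2.2.2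
      exact ⟨v, mul_ne_zero (Units.ne_zero _) hv⟩
    refine ⟨hmem, (hψ _ hmem (hlift _ hmem)).trans
      (quotientSpace.mk_eq_mk.2 ⟨fun i => Option.elim i 1 g,
        mem_rankThreeStack_group.2 ⟨g, hg, 1, fun v => by simp, by simp⟩, fun i => ?_⟩).symm⟩
    cases i with
    | none => simp [liftedChartPoint, hu]
    | some v => exact chartPoint_eq_smul (z := fun v => z (some v)) h1 hk v
  refine ⟨ψ, hψ, fun z hz => ⟨?_, ?_⟩, ?_⟩
  · rintro ⟨x, hx⟩
    induction x using quotientSpace.ind with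
    | h y hy =>
      rw [hψ y hy (hlift y hy)] at hx
      obtain ⟨t, -, h⟩ := quotientSpace.mk_eq_mk.1 hx
      simp [h, liftedChartPoint]
  · rintro ⟨h1, hk⟩
    obtain ⟨g, hg, h1', hk'⟩ := exists_normalizing (z := fun v => z (some v)) ω ha h1 hk
    obtain ⟨u, hu⟩ := IsAlgClosed.exists_pow_nat_eq (z none) (ha k)
    obtain ⟨_, h⟩ := hnorm z hz g u hg h1' hk' hu
    exact ⟨_, h⟩
  · have hinj : Function.Injective ψ := by
      intro x y hxy
      induction x using quotientSpace.ind with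
      | h z hz =>
        induction y using quotientSpace.ind with
        | h w hw =>
          rw [hψ z hz (hlift z hz), hψ w hw (hlift w hw)] at hxy
          obtain ⟨s, hs, h⟩ := quotientSpace.mk_eq_mk.1 hxy
          obtain ⟨g, hg, u, hsg, hsn⟩ := mem_rankThreeStack_group.1 hs
          have h1 : g (Sum.inl 1) = 1 := by
            have := h (some (Sum.inl 1))
            simp only [liftedChartPoint, Option.elim, hsg, chartPoint_inl_one,
              blowUpWeight_inl_one, pow_zero, mul_one] at this
            exact Units.ext this.symm
          have hk : g (Sum.inr k) = 1 := by
            have := h (some (Sum.inr k))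
            simp only [liftedChartPoint, Option.elim, hsg, chartPoint_inr_self,
              blowUpWeight_inr_self, pow_zero, mul_one] at this
            exact Units.ext this.symm
          obtain ⟨ε, hε, hv⟩ := exists_root_of_mem_group hg h1 hk
          obtain ⟨η, hη, e⟩ := exists_root_of_pow_eq (ha k) (x := w none)
            (y := (u⁻¹ : ℂˣ) * z none) (by
              have := h none
              simp only [liftedChartPoint, Option.elim, hsn] at this
              rw [this, mul_pow]
              simp)
          -- The third torus parameter is determined by $\xi=u^{a_k}$ only up to $\eta$. Replacing
          -- $(u,\varepsilon)$ by $(u\eta^{-1},\varepsilon\eta)$ corrects the last coordinate and,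
          -- by $b\equiv c$, leaves the action on the $z_v$ unchanged.
          refine quotientSpace.mk_eq_mk.2 ⟨fun i => Option.elim i (η * u⁻¹) fun v =>
            g v.1 * u ^ blowUpWeight k b v.1, ⟨u * η⁻¹, ε * η, mul_mem hε hη, fun v => ?_, ?_⟩,
            fun i => ?_⟩
          · simp only [Option.elim, hv, mul_pow, inv_pow]
            rw [pow_eq_pow_of_modEq (hcb v) hη, mul_comm (ε ^ _) (η ^ _), mul_assoc,
              inv_mul_cancel_left, mul_comm]
          · simp
          · cases i with
            | none => simp [e, mul_assoc]
            | some v =>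
              have := h (some v.1)
              simp only [liftedChartPoint, Option.elim, hsg, chartPoint_coe] at this
              exact this
    refine isOpenImmersionOn_of_transfer (fun z hz => smul_mem_weightedBlowUp hz)
      (isMorphism_of_polynomial (fun z hz => smul_mem_rankThreeStack hz)
        (fun i => i.elim (X none ^ a k) fun v =>
          if h : v ≠ Sum.inl 1 ∧ v ≠ Sum.inr k then X (some ⟨v, h⟩) else 1) fun z hz => ?_)
      isOpen_univ hinj.injOn ?_
    · have e : (fun i => eval z (Option.elim i (X none ^ a k) fun v =>
          if h : v ≠ Sum.inl 1 ∧ v ≠ Sum.inr k then X (some ⟨v, h⟩) else 1)) =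
          liftedChartPoint (a k) z := by
        funext i
        cases i with
        | none => simp [liftedChartPoint]
        | some v =>
          by_cases h : v ≠ Sum.inl 1 ∧ v ≠ Sum.inr k <;>
            simp [liftedChartPoint, chartPoint, h]
      rw [e]
      exact ⟨hlift z hz, hψ z hz _⟩
    · rintro S hS w - w' hw' ⟨hw, _, -, hww⟩ ⟨d₀, hd₀, hne⟩
      obtain ⟨E, hE⟩ := exists_normalized_polynomial ω ha S (fun d v => d (some v)) _
        fun d hd => hS.weightedBlowUpGroup_modEq (ha k) hd hd₀
      refine ⟨X (some (Sum.inl 1)) * X (some (Sum.inr k)) * X none ^ (d₀ none % a k),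
        fun d => X none ^ (d none / a k) * rename some (E d), ?_, fun z' hz' hne' => ?_⟩
      · rw [hψ w hw (hlift w hw)] at hww
        obtain ⟨t, -, h⟩ := quotientSpace.mk_eq_mk.1 hww
        -- On the exceptional divisor a nonvanishing monomial does not involve $u$, so the power of
        -- $\xi$ in the localising polynomial is trivial there.
        have hw0 : w none = 0 → d₀ none = 0 := fun h0 => by
          by_contra hd
          exact hne (Finset.prod_eq_zero (Finset.mem_univ none) (by rw [h0, zero_pow hd]))
        by_cases h0 : w none = 0
        · simp [h, liftedChartPoint, hw0 h0]
        · simp [h, liftedChartPoint, h0]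
      · simp only [map_mul, map_pow, eval_X] at hne'
        obtain ⟨u, hu⟩ := IsAlgClosed.exists_pow_nat_eq (z' none) (ha k)
        obtain ⟨g, hg, h1', hk', μ, hμ, h⟩ := hE (fun v => z' (some v))
          (left_ne_zero_of_mul (left_ne_zero_of_mul hne'))
          (right_ne_zero_of_mul (left_ne_zero_of_mul hne'))
        obtain ⟨hst, hst'⟩ := hnorm z' hz' g u hg h1' hk' hu
        refine ⟨_, hst, ⟨hst, hz', trivial, hst'⟩, μ * u ^ (d₀ none % a k),
          mul_ne_zero hμ ?_, fun d hd => ?_⟩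
        · have := right_ne_zero_of_mul hne'
          rw [← hu, pow_right_comm] at this
          exact (pow_ne_zero_iff (ha k).ne').1 this
        · have e1 : u ^ d none = u ^ (d₀ none % a k) * z' none ^ (d none / a k) := by
            rw [← hS.weightedBlowUpGroup_none_modEq (ha k) hcb hd hd₀, ← hu, ← pow_mul, ← pow_add,
              Nat.mod_add_div]
          rw [monomialValue, Fintype.prod_option]
          simp only [Option.elim]
          rw [h d hd, e1, map_mul, map_pow, eval_X, eval_rename]
          simp only [Function.comp_def]
          ring

end BlowUp

end ToricBlowUp

/-! ### The toric weighted blow up of the bundle -/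

theorem proposition3p4 (m : ℕ) (ω a : Fin (m + 1) → ℕ) (ha0 : a 0 = 1) (ha : ∀ i, 0 < a i)
    (hwf : ToricBlowUp.WellFormed a) (k : Fin (m + 1)) (b : Fin (m + 1) → ℕ) (hb : ∀ i, 0 < b i)
    (hbi : ∀ i, i ≠ k → b i ≡ a i [MOD a k]) (hbk : ∃ r : ℕ, 0 < r ∧ b k = r * a k) :
    -- the fan of `F`, and the Cox data of `F`
    (ToricBlowUp.bundleFan ω a).IsFan ∧
    (ToricBlowUp.bundleFan ω a).irrelevantIdeal =
      (ToricBlowUp.weightedBundle ω a).irrelevantIdeal ∧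
    (ToricBlowUp.bundleFan ω a).coxGroup = (ToricBlowUp.weightedBundle ω a).group ∧
    Function.Injective (ToricBlowUp.weightHom (ToricBlowUp.weightedBundle ω a).weights) ∧
    -- `T` has rank 3 and is given by the star subdivision of the fan of `F` at a lattice vector `γ`
    -- in the interior of the cone of the point
    ((ToricBlowUp.rankThreeStack ω a k b).weights.map (Int.cast : ℤ → ℚ)).rank = 3 ∧
    (∃ γ : Fin (m + 1) → ℤ,
      (a k : ℤ) • γ =
        ∑ v, (ToricBlowUp.blowUpWeight k b v : ℤ) • (ToricBlowUp.bundleFan ω a).ray v ∧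
      ((ToricBlowUp.bundleFan ω a).starSubdivision γ).IsFan ∧
      ((ToricBlowUp.bundleFan ω a).starSubdivision γ).irrelevantIdeal =
        (ToricBlowUp.rankThreeStack ω a k b).irrelevantIdeal ∧
      ((ToricBlowUp.bundleFan ω a).starSubdivision γ).coxGroup =
        (ToricBlowUp.rankThreeStack ω a k b).group) ∧
    IsCyclic (ToricBlowUp.weightHom (ToricBlowUp.rankThreeStack ω a k b).weights).ker ∧
    Nat.card (ToricBlowUp.weightHom (ToricBlowUp.rankThreeStack ω a k b).weights).ker = a k ∧
    -- the blow up morphism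
    ∃ (π : (ToricBlowUp.rankThreeStack ω a k b).variety →
        (ToricBlowUp.weightedBundle ω a).variety)
      (p : (ToricBlowUp.weightedBundle ω a).variety)
      (φ : ToricBlowUp.cyclicQuotient (a k) (ToricBlowUp.chartType a k) →
        (ToricBlowUp.weightedBundle ω a).variety),
      (∃ h, p = ToricBlowUp.quotientSpace.mk (ToricBlowUp.basePoint k) h) ∧
      (∀ z, ∃ h, φ (ToricBlowUp.cyclicQuotient.mk z) =
        ToricBlowUp.quotientSpace.mk (ToricBlowUp.chartPoint z) h) ∧
      (∀ z hz, ∀ ζ : ℂ, ζ ^ a k = z none → ∃ h,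
        π (ToricBlowUp.quotientSpace.mk z hz) =
          ToricBlowUp.quotientSpace.mk
            (fun v => ζ ^ ToricBlowUp.blowUpWeight k b v * z (some v)) h) ∧
      (∀ z hz, π (ToricBlowUp.quotientSpace.mk z hz) = p ↔ z none = 0) ∧
      ToricBlowUp.IsWeightedBlowUp π p φ (fun v => ToricBlowUp.blowUpWeight k b v.1) := by
  open ToricBlowUp in
  obtain ⟨γ, hγ⟩ := exists_center (ω := ω) ha0 hbi hbk
  have : NeZero (a k) := ⟨(ha k).ne'⟩
  let e := kerEquivRootsOfUnity (ω := ω) ha0 hbi hbk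
  obtain ⟨π, p, hp, hπ, hπp, hoff, hsurj⟩ := exists_blowDown (ω := ω) ha hb hbi hbk
  obtain ⟨φ, hφ, hφr, hφo⟩ := exists_chart (ω := ω) ha k
  obtain ⟨ψ, hψ, hψr, hψo⟩ := exists_liftedChart (ω := ω) ha hbi hbk
  have hbase : basePoint k ∈ stableLocus (weightedBundle ω a).irrelevantIdeal :=
    basePoint_eq (k := k) ▸ chartPoint_mem_stableLocus _
  refine ⟨bundleFan_isFan ha0 ha hwf, bundleFan_irrelevantIdeal, bundleFan_coxGroup ha0,
    weightHom_weightedBundle_injective ha0, rankThreeStack_weights_rank ha,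
    ⟨γ, hγ, starSubdivision_isFan ha0 ha hwf hb hγ, starSubdivision_irrelevantIdeal ha0 ha hb hγ,
      starSubdivision_coxGroup ha0 ha hγ⟩,
    isCyclic_of_surjective e.symm e.symm.surjective,
    (Nat.card_congr e.toEquiv).trans ?_, π, p, φ, ⟨hbase, hp hbase⟩,
    fun z => ⟨chartPoint_mem_stableLocus z, hφ z _⟩,
    fun z hz ζ hζ => ⟨blowDown_mem_stableLocus ha hz hζ, hπ z hz ζ _ hζ⟩, hπp, ?_⟩
  · rw [Complex.card_rootsOfUnity]
  refine ⟨hφo, ?_, fun v => Nat.pos_of_ne_zero (chartVar_blowUpWeight_ne_zero hb v),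
    -- The multiple is $j=1$: the weights $b$ are themselves congruent to the type of the
    -- singularity.
    ⟨1, fun v => by simpa using blowUpWeight_modEq_chartType hbi hbk v⟩, hoff, hsurj,
    ψ, hψo, ?_, fun w hw => ?_⟩
  · rw [hp hbase, hφ 0 (chartPoint_mem_stableLocus 0)]
    congr 1
    exact basePoint_eq.symm
  -- Both sides are the locus $X_1Y_k\ne0$, since $\pi$ leaves these two coordinates unchanged.
  · ext x
    induction x using quotientSpace.ind with
    | h z hz =>
      obtain ⟨ζ, hζ⟩ := IsAlgClosed.exists_pow_nat_eq (z none) (ha k)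
      rw [hψr, Set.mem_preimage, hπ z hz ζ (blowDown_mem_stableLocus ha hz hζ) hζ, hφr]
      simp [blowDown]
  · have hst : liftedChartPoint (a k) w ∈ stableLocus (rankThreeStack ω a k b).irrelevantIdeal :=
      liftedChartPoint_mem_stableLocus (mem_stableLocus_weightedBlowUp.1 hw)
    -- On the lifted chart $\xi=u^{a_k}$, so $u$ itself is an admissible root and $\pi$ becomes
    -- $(z,u)\mapsto(u^{b_v}z_v)$.
    have e : blowDown k b (liftedChartPoint (a k) w) (w none) =
        chartPoint fun v => w none ^ blowUpWeight k b v.1 * w (some v) := by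
      funext v
      refine forall_bundleVar k (p := fun v => blowDown k b (liftedChartPoint (a k) w) (w none) v =
        chartPoint (fun v : ChartVar k => w none ^ blowUpWeight k b v.1 * w (some v)) v)
        ?_ ?_ (fun v => ?_) v <;> simp [blowDown, liftedChartPoint]
    rw [hψ w hw hst, hπ _ hst (w none) (e ▸ chartPoint_mem_stableLocus _) rfl,
      hφ _ (chartPoint_mem_stableLocus _)]
    congr 1
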